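/- \textbf{Theorem (Mayer--Vietoris for magnitude homology of directed graphs).} \emph{Conventions.} A directed graph $G$ has a set $V(G)$ of vertices and a set $E(G)\subseteq V(G)\times V(G)$ of edges (loops allowed). A map of directed graphs $G\to H$ is a function $f\colon V(G)\to V(H)$ such that for each edge $x\to y$ of $G$ either $f(x)=f(y)$ or $f(x)\to f(y)$ is an edge of $H$. Let $d(x,y)\in\mathbb{N}\cup\{\infty\}$ be the least number of edges in a directed path from $x$ to $y$, and let $\ell(x_0,\dots,x_k)=\sum_{i<k} d(x_i,x_{i+1})$. Fix a commutative ring $R$. For $\ell\ge 0$, $\mathrm{MC}_{k,\ell}(G)$ is the free $R$-module on the tuples $(x_0,\dots,x_k)$ of vertices of $G$ with consecutive entries distinct and of length exactly $\ell$; the differential is $\partial(x_0,\dots,x_k)=\sum_{i=0}^k(-1)^i(x_0,\dots,\widehat{x_i},\dots,x_k)$, where the terms of length less than $\ell$ are omitted. The magnitude homology is $\mathrm{MH}_{k,\ell}(G)=H_k(\mathrm{MC}_{*,\ell}(G))$. A map $f\colon G\to H$ induces $f_*\colon \mathrm{MH}_{k,\ell}(G)\to\mathrm{MH}_{k,\ell}(H)$,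 by sending a generator $(x_0,\dots,x_k)$ to $(f(x_0),\dots,f(x_k))$ if this tuple has length $\ell$, and to $0$ otherwise. A \emph{cofibration} $A\to X$ is an induced subgraph inclusion such that (1) $X$ has no edge from a vertex not in $A$ to a vertex in $A$; and (2) for each vertex $x$ of $X$ that admits a directed path from some vertex of $A$ there is a vertex $\pi(x)\in A$ with $d(a,x)=d(a,\pi(x))+d(\pi(x),x)$ for every $a\in A$, where $d$ is taken in $X$. \emph{Statement.} Let $i\colon A\to X$ be a cofibration and $f\colon A\to Y$ any map of directed graphs, and let $$\begin{array}{ccc} A & \xrightarrow{\ f\ } & Y\\ {\scriptstyle i}\downarrow & & \downarrow{\scriptstyle j}\\ X & \xrightarrow{\ g\ } & X\cup_A Y\end{array}$$ be a pushout square in the category of directed graphs. Then for all $k,\ell\ge 0$ the sequence of $R$-modules $$0\to \mathrm{MH}_{k,\ell}(A)\xrightarrow{(i_*,\,-f_*)}\mathrm{MH}_{k,\ell}(X)\oplus\mathrm{MH}_{k,\ell}(Y)\xrightarrow{g_*\oplus j_*}\mathrm{MH}_{k,\ell}(X\cup_A Y)\to 0$$ is short exact and split, where $(g_*\oplus j_*)(x,y)=g_*x+j_*y$.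 -/

import Mathlib

open CategoryTheory CategoryTheory.Limits

universe u v

/-- A directed graph: a set of vertices together with a set of ordered pairs of vertices, the
edges. Loops are permitted, parallel edges are not. -/
structure DirGraph : Type (u + 1) where
  /-- the vertices -/
  V : Type u
  /-- the edges: `graph.Adj x y` says that there is an edge `x → y` -/
  graph : Digraph V

namespace DirGraph

/-- A map of directed graphs: each edge `x → y` is either collapsed to a vertex or sent to an
edge. -/
@[ext]
structure Hom (G H : DirGraph.{u}) : Type u where
  /-- the function on vertices -/
  toFun : G.V → H.V
  map_adj : ∀ ⦃x y : G.V⦄, G.graph.Adj x y → toFun x = toFun y ∨ H.graph.Adj (toFun x) (toFun y)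

/-- The category of directed graphs and maps of directed graphs. -/
instance : Category DirGraph.{u} where
  Hom := Hom
  id G := ⟨id, fun _ _ h => Or.inr h⟩
  comp f g := ⟨g.toFun ∘ f.toFun, fun x y h => by
    rcases f.map_adj h with h | h
    · exact Or.inl (congrArg g.toFun h)
    · exact g.map_adj h⟩

/-- The function on vertices underlying a map of directed graphs. -/
def vmap {G H : DirGraph.{u}} (f : G ⟶ H) : G.V → H.V := Hom.toFun f

theorem vmap_id (G : DirGraph.{u}) : vmap (𝟙 G) = id := rfl

theorem vmap_comp {G H K : DirGraph.{u}} (f : G ⟶ H) (g : H ⟶ K) :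
    vmap (f ≫ g) = vmap g ∘ vmap f := rfl

theorem vmap_adj {G H : DirGraph.{u}} (f : G ⟶ H) {x y : G.V} (h : G.graph.Adj x y) :
    vmap f x = vmap f y ∨ H.graph.Adj (vmap f x) (vmap f y) := Hom.map_adj f h

variable {G H K : DirGraph.{u}}

/-- `G.HasPath n x y`: there is a directed path `x = x₀ → x₁ → ⋯ → xₙ = y` with `n` edges. -/
inductive HasPath (G : DirGraph.{u}) : ℕ → G.V → G.V → Prop
  | nil (x : G.V) : HasPath G 0 x x
  | cons {n : ℕ} {x y z : G.V} : G.graph.Adj x y → HasPath G n y z → HasPath G (n + 1) x z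

/-- The shortest path metric: the least number of edges in a directed path from `x` to `y`,
and `⊤` if there is none. -/
noncomputable def dist (G : DirGraph.{u}) (x y : G.V) : ℕ∞ :=
  ⨅ (n : ℕ) (_ : G.HasPath n x y), (n : ℕ∞)

theorem HasPath.trans {m n : ℕ} {x y z : G.V} (h : G.HasPath m x y) (h' : G.HasPath n y z) :
    G.HasPath (m + n) x z := by
  induction h with
  | nil x => simpa using h'
  | cons e _ ih => rw [Nat.add_right_comm]; exact .cons e (ih h')

theorem HasPath.map {n : ℕ} {x y : G.V} (h : G.HasPath n x y) (f : G ⟶ H) :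
    ∃ m ≤ n, H.HasPath m (vmap f x) (vmap f y) := by
  induction h with
  | nil x => exact ⟨0, le_rfl, .nil _⟩
  | cons e _ ih =>
    obtain ⟨m, hm, hp⟩ := ih
    rcases vmap_adj f e with e | e
    · exact ⟨m, by omega, e ▸ hp⟩
    · exact ⟨m + 1, by omega, .cons e hp⟩

theorem dist_le_of_hasPath {n : ℕ} {x y : G.V} (h : G.HasPath n x y) : G.dist x y ≤ n :=
  iInf₂_le n h

theorem exists_hasPath_of_dist_ne_top {x y : G.V} (h : G.dist x y ≠ ⊤) :
    ∃ n : ℕ, G.HasPath n x y ∧ G.dist x y = n := by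
  classical
  have hex : ∃ n, G.HasPath n x y := by
    by_contra hc
    push Not at hc
    exact h (by simp [dist, hc])
  refine ⟨Nat.find hex, Nat.find_spec hex, le_antisymm (dist_le_of_hasPath (Nat.find_spec hex)) ?_⟩
  exact le_iInf₂ fun n hn => by exact_mod_cast Nat.find_min' hex hn

theorem dist_self (x : G.V) : G.dist x x = 0 :=
  le_antisymm (by simpa using dist_le_of_hasPath (HasPath.nil x)) bot_le

theorem eq_of_dist_eq_zero {x y : G.V} (h : G.dist x y = 0) : x = y := by
  obtain ⟨n, hn, hd⟩ := exists_hasPath_of_dist_ne_top (x := x) (y := y) (by simp [h])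
  obtain rfl : n = 0 := by exact_mod_cast hd.symm.trans h
  cases hn
  rfl

theorem dist_triangle (x y z : G.V) : G.dist x z ≤ G.dist x y + G.dist y z := by
  by_cases h : G.dist x y = ⊤
  · simp [h]
  by_cases h' : G.dist y z = ⊤
  · simp [h']
  obtain ⟨m, hm, em⟩ := exists_hasPath_of_dist_ne_top h
  obtain ⟨n, hn, en⟩ := exists_hasPath_of_dist_ne_top h'
  rw [em, en]
  exact_mod_cast dist_le_of_hasPath (hm.trans hn)

theorem dist_map_le (f : G ⟶ H) (x y : G.V) : H.dist (vmap f x) (vmap f y) ≤ G.dist x y := by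
  by_cases h : G.dist x y = ⊤
  · simp [h]
  obtain ⟨n, hn, en⟩ := exists_hasPath_of_dist_ne_top h
  obtain ⟨m, hmn, hm⟩ := hn.map f
  rw [en]
  exact (dist_le_of_hasPath hm).trans (by exact_mod_cast hmn)

/-! ### Cofibrations -/

/-- The vertices of the reach of the image of `i : A ⟶ X`: those admitting a directed path from
some vertex of `A`. -/
def reach {A X : DirGraph.{u}} (i : A ⟶ X) : Set X.V :=
  {x | ∃ (a : A.V) (n : ℕ), X.HasPath n (vmap i a) x}

/-- `i : A ⟶ X` is a cofibration of directed graphs. -/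
structure IsCofibration {A X : DirGraph.{u}} (i : A ⟶ X) : Prop where
  /-- `i` is the inclusion of a subgraph -/
  injective : Function.Injective (vmap i)
  /-- which is an induced subgraph. -/
  induced : ∀ a b : A.V, A.graph.Adj a b ↔ X.graph.Adj (vmap i a) (vmap i b)
  /-- There are no edges from vertices not in `A` to vertices in `A`. -/
  no_edge : ∀ (x : X.V) (a : A.V), x ∉ Set.range (vmap i) → ¬ X.graph.Adj x (vmap i a)
  /-- Each vertex in the reach of `A` has a projection `p` to `A`. -/
  exists_proj : ∀ x ∈ reach i, ∃ p : A.V, ∀ a : A.V,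
    X.dist (vmap i a) x = X.dist (vmap i a) (vmap i p) + X.dist (vmap i p) x

/-! ### Tuples of vertices and their length -/

/-- The length `d(x₀, x₁) + ⋯ + d(x_{k-1}, x_k)` of a tuple of vertices. -/
noncomputable def length (G : DirGraph.{u}) {k : ℕ} (x : Fin (k + 1) → G.V) : ℕ∞ :=
  ∑ i : Fin k, G.dist (x i.castSucc) (x i.succ)

/-- `x` generates the magnitude chains in bidegree `(k, ℓ)`: consecutive entries are distinct, and
the length is `ℓ`. As `ℓ` is finite, there is a directed path from each entry to the next. -/
def IsGen (G : DirGraph.{u}) (k ℓ : ℕ) (x : Fin (k + 1) → G.V) : Prop :=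
  (∀ i : Fin k, x i.castSucc ≠ x i.succ) ∧ G.length x = ℓ

theorem length_succ {k : ℕ} (x : Fin (k + 2) → G.V) :
    G.length x = G.dist (x 0) (x 1) + G.length (Fin.tail x) := by
  simp [length, Fin.sum_univ_succ, Fin.tail]

theorem tail_removeNth_succ {α : Type*} {k : ℕ} (x : Fin (k + 2) → α) (i : Fin (k + 1)) :
    Fin.tail (i.succ.removeNth x) = i.removeNth (Fin.tail x) := by
  funext j
  simp [Fin.tail, Fin.removeNth]

theorem removeNth_succ_zero {α : Type*} {k : ℕ} (x : Fin (k + 2) → α) (i : Fin (k + 1)) :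
    i.succ.removeNth x 0 = x 0 := by
  simp [Fin.removeNth]

theorem removeNth_zero_eq_tail {α : Type*} {k : ℕ} (x : Fin (k + 1) → α) :
    (0 : Fin (k + 1)).removeNth x = Fin.tail x := by
  funext j
  simp [Fin.tail, Fin.removeNth]

theorem length_removeNth_le {k : ℕ} (x : Fin (k + 2) → G.V) (i : Fin (k + 2)) :
    G.length (i.removeNth x) ≤ G.length x := by
  induction k with
  | zero => simp [length]
  | succ k ih =>
    cases i using Fin.cases with
    | zero =>
      rw [removeNth_zero_eq_tail, length_succ x]
      exact le_add_self
    | succ i =>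
      have h1 : i.succ.removeNth x 1 = i.removeNth (Fin.tail x) 0 := by
        rw [← tail_removeNth_succ]; rfl
      rw [length_succ, tail_removeNth_succ, removeNth_succ_zero, h1, length_succ x]
      cases i using Fin.cases with
      | zero =>
        rw [removeNth_zero_eq_tail, length_succ (Fin.tail x), ← add_assoc]
        exact add_le_add_left (dist_triangle _ _ _) _
      | succ i =>
        rw [removeNth_succ_zero]
        exact add_le_add_right (ih _ _) _

/-- A face of a generator that has the same length is again a generator. -/
theorem IsGen.removeNth {k ℓ : ℕ} {x : Fin (k + 2) → G.V} (hx : G.IsGen (k + 1) ℓ x)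
    {i : Fin (k + 2)} (hi : G.length (i.removeNth x) = ℓ) : G.IsGen k ℓ (i.removeNth x) := by
  refine ⟨?_, hi⟩
  obtain ⟨hne, hl⟩ := hx
  have hfin : G.length x ≠ ⊤ := by simp [hl]
  replace hi := hi.trans hl.symm
  clear hl ℓ
  induction k with
  | zero => exact fun j => j.elim0
  | succ k ih =>
    rw [length_succ x] at hfin hi
    obtain ⟨hd, ht⟩ := WithTop.add_ne_top.1 hfin
    rw [Fin.forall_fin_succ] at hne
    obtain ⟨hne0, hne⟩ := hne
    cases i using Fin.cases with
    | zero =>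
      rw [removeNth_zero_eq_tail]
      exact hne
    | succ i =>
      have h1 : i.succ.removeNth x 1 = i.removeNth (Fin.tail x) 0 := by
        rw [← tail_removeNth_succ]; rfl
      have h2 : ∀ j : Fin (k + 1), i.succ.removeNth x j.succ = i.removeNth (Fin.tail x) j :=
        fun j => by rw [← tail_removeNth_succ]; rfl
      rw [length_succ, tail_removeNth_succ, removeNth_succ_zero, h1] at hi
      rw [Fin.forall_fin_succ]
      cases i using Fin.cases with
      | zero =>
        refine ⟨?_, fun j => ?_⟩
        · intro h
          rw [Fin.castSucc_zero, removeNth_succ_zero, h2] at h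
          rw [← h, dist_self, zero_add, removeNth_zero_eq_tail, length_succ (Fin.tail x),
            ← add_assoc] at hi
          rw [length_succ (Fin.tail x)] at ht
          obtain ⟨hd', ht⟩ := WithTop.add_ne_top.1 ht
          have h0 : G.dist (x 0) (x 1) + G.dist (Fin.tail x 0) (Fin.tail x 1) = 0 :=
            (WithTop.add_right_inj (α := ℕ) ht).1 (hi.symm.trans (zero_add _).symm)
          exact hne0 (eq_of_dist_eq_zero (add_eq_zero.1 h0).1)
        · rw [← Fin.succ_castSucc, h2, h2, removeNth_zero_eq_tail]
          exact hne j.succ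
      | succ i =>
        rw [removeNth_succ_zero] at hi
        have hi' := (WithTop.add_left_inj (α := ℕ) hd).1 hi
        have := ih (x := Fin.tail x) (i := i.succ) hne ht hi'
        refine ⟨?_, fun j => ?_⟩
        · rw [Fin.castSucc_zero, removeNth_succ_zero, h2, removeNth_succ_zero]
          exact hne0
        · rw [← Fin.succ_castSucc, h2, h2]
          exact this j

theorem length_map_le {k : ℕ} (f : G ⟶ H) (x : Fin (k + 1) → G.V) :
    H.length (vmap f ∘ x) ≤ G.length x :=
  Finset.sum_le_sum fun _ _ => dist_map_le f _ _

theorem IsGen.map {k ℓ : ℕ} {x : Fin (k + 1) → G.V} (hx : G.IsGen k ℓ x) (f : G ⟶ H)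
    (hf : H.length (vmap f ∘ x) = ℓ) : H.IsGen k ℓ (vmap f ∘ x) := by
  refine ⟨fun i h => ?_, hf⟩
  have hlt : H.length (vmap f ∘ x) < G.length x := by
    have hpos : G.dist (x i.castSucc) (x i.succ) ≠ 0 := fun h0 => hx.1 i (eq_of_dist_eq_zero h0)
    have hle : H.length (vmap f ∘ x) + G.dist (x i.castSucc) (x i.succ) ≤ G.length x := by
      unfold length
      rw [← Finset.add_sum_erase _ _ (Finset.mem_univ i),
        ← Finset.add_sum_erase _ (fun i => G.dist (x i.castSucc) (x i.succ)) (Finset.mem_univ i)]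
      rw [h, dist_self, zero_add, add_comm]
      exact add_le_add_right (Finset.sum_le_sum fun _ _ => dist_map_le f _ _) _
    refine lt_of_lt_of_le ?_ hle
    rw [add_comm (H.length _)]
    exact ENat.lt_add_left (by simp [hf]) (pos_iff_ne_zero.2 hpos)
  rw [hf, hx.2] at hlt
  exact lt_irrefl _ hlt

/-! ### Magnitude chains and magnitude homology -/

variable (R : Type v) [CommRing R]

/-- The generators of the magnitude chains in bidegree `(k, ℓ)`. -/
abbrev Gen (G : DirGraph.{u}) (k ℓ : ℕ) : Type u := {x : Fin (k + 1) → G.V // G.IsGen k ℓ x}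

open Classical in
/-- The magnitude chain given by a tuple of vertices if that tuple is a generator in bidegree
`(k, ℓ)`, and `0` otherwise. -/
noncomputable def chain (G : DirGraph.{u}) (k ℓ : ℕ) (x : Fin (k + 1) → G.V) : G.Gen k ℓ →₀ R :=
  if h : G.IsGen k ℓ x then Finsupp.single ⟨x, h⟩ 1 else 0

/-- The differential of the magnitude chains: the alternating sum of the tuples obtained by
deleting an entry, those which are not generators of the same length being omitted. -/
noncomputable def boundary (G : DirGraph.{u}) (k ℓ : ℕ) :
    (G.Gen (k + 1) ℓ →₀ R) →ₗ[R] (G.Gen k ℓ →₀ R) :=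
  Finsupp.linearCombination R fun x =>
    ∑ i : Fin (k + 2), (-1 : R) ^ (i : ℕ) • chain R G k ℓ (i.removeNth x.1)

/-- The map on magnitude chains induced by a map of directed graphs: a tuple is sent to its image
if that is a generator of the same length, and to `0` otherwise. -/
noncomputable def chainMap (f : G ⟶ H) (k ℓ : ℕ) : (G.Gen k ℓ →₀ R) →ₗ[R] (H.Gen k ℓ →₀ R) :=
  Finsupp.linearCombination R fun x => chain R H k ℓ (vmap f ∘ x.1)

theorem chain_of_isGen {k ℓ : ℕ} {x : Fin (k + 1) → G.V} (h : G.IsGen k ℓ x) :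
    chain R G k ℓ x = Finsupp.single ⟨x, h⟩ 1 := dif_pos h

theorem chain_of_not_isGen {k ℓ : ℕ} {x : Fin (k + 1) → G.V} (h : ¬ G.IsGen k ℓ x) :
    chain R G k ℓ x = 0 := dif_neg h

theorem boundary_single {k ℓ : ℕ} (x : G.Gen (k + 1) ℓ) :
    boundary R G k ℓ (Finsupp.single x 1) =
      ∑ i : Fin (k + 2), (-1 : R) ^ (i : ℕ) • chain R G k ℓ (i.removeNth x.1) := by
  simp [boundary]

theorem chainMap_single {k ℓ : ℕ} (f : G ⟶ H) (x : G.Gen k ℓ) :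
    chainMap R f k ℓ (Finsupp.single x 1) = chain R H k ℓ (vmap f ∘ x.1) := by
  simp [chainMap]

theorem boundary_chain {k ℓ : ℕ} {x : Fin (k + 2) → G.V}
    (hx : G.IsGen (k + 1) ℓ x ∨ G.length x < ℓ) :
    boundary R G k ℓ (chain R G (k + 1) ℓ x) =
      ∑ i : Fin (k + 2), (-1 : R) ^ (i : ℕ) • chain R G k ℓ (i.removeNth x) := by
  by_cases h : G.IsGen (k + 1) ℓ x
  · rw [chain_of_isGen R h, boundary_single]
  · have hlt := hx.resolve_left h
    rw [chain_of_not_isGen R h, map_zero, Finset.sum_eq_zero]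
    intro i _
    rw [chain_of_not_isGen, smul_zero]
    exact fun h' => ((length_removeNth_le x i).trans_lt hlt).ne h'.2

theorem chainMap_chain {k ℓ : ℕ} (f : G ⟶ H) {x : Fin (k + 1) → G.V}
    (hx : G.IsGen k ℓ x ∨ G.length x < ℓ) :
    chainMap R f k ℓ (chain R G k ℓ x) = chain R H k ℓ (vmap f ∘ x) := by
  by_cases h : G.IsGen k ℓ x
  · rw [chain_of_isGen R h, chainMap_single]
  · have hlt := hx.resolve_left h
    rw [chain_of_not_isGen R h, map_zero, chain_of_not_isGen]
    exact fun h' => ((length_map_le f x).trans_lt hlt).ne h'.2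

theorem IsGen.removeNth_or {k ℓ : ℕ} {x : Fin (k + 2) → G.V} (hx : G.IsGen (k + 1) ℓ x)
    (i : Fin (k + 2)) : G.IsGen k ℓ (i.removeNth x) ∨ G.length (i.removeNth x) < ℓ := by
  rcases (length_removeNth_le x i).lt_or_eq with h | h
  · exact Or.inr (hx.2 ▸ h)
  · exact Or.inl (hx.removeNth (h.trans hx.2))

theorem IsGen.map_or {k ℓ : ℕ} {x : Fin (k + 1) → G.V} (hx : G.IsGen k ℓ x) (f : G ⟶ H) :
    H.IsGen k ℓ (vmap f ∘ x) ∨ H.length (vmap f ∘ x) < ℓ := by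
  rcases (length_map_le f x).lt_or_eq with h | h
  · exact Or.inr (hx.2 ▸ h)
  · exact Or.inl (hx.map f (h.trans hx.2))

theorem boundary_comp_boundary (G : DirGraph.{u}) (k ℓ : ℕ) :
    boundary R G k ℓ ∘ₗ boundary R G (k + 1) ℓ = 0 := by
  refine Finsupp.lhom_ext' fun x => LinearMap.ext_ring ?_
  simp only [LinearMap.comp_apply, Finsupp.lsingle_apply, LinearMap.zero_apply]
  rw [boundary_single, map_sum]
  simp only [map_smul, boundary_chain R (x.2.removeNth_or _), Finset.smul_sum, smul_smul,
    ← pow_add]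
  rw [← Finset.sum_product', Finset.univ_product_univ]
  refine Finset.sum_involution (fun p _ => (p.1.succAbove p.2, p.2.predAbove p.1)) ?_ ?_ ?_ ?_
  · rintro ⟨i, j⟩ _
    dsimp only
    rw [← Fin.removeNth_removeNth_eq_swap, Fin.neg_one_pow_succAbove_add_predAbove, neg_smul,
      add_neg_cancel]
  · rintro ⟨i, j⟩ _ _ h
    exact Fin.succAbove_ne i j (congrArg Prod.fst h)
  · exact fun _ _ => Finset.mem_univ _
  · rintro ⟨i, j⟩ _
    exact Prod.ext (Fin.succAbove_succAbove_predAbove i j) (Fin.predAbove_predAbove_succAbove i j)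

theorem chainMap_comp_boundary (f : G ⟶ H) (k ℓ : ℕ) :
    chainMap R f k ℓ ∘ₗ boundary R G k ℓ = boundary R H k ℓ ∘ₗ chainMap R f (k + 1) ℓ := by
  refine Finsupp.lhom_ext' fun x => LinearMap.ext_ring ?_
  simp only [LinearMap.comp_apply, Finsupp.lsingle_apply]
  rw [boundary_single, chainMap_single, boundary_chain R (x.2.map_or f), map_sum]
  refine Finset.sum_congr rfl fun i _ => ?_
  rw [map_smul, chainMap_chain R f (x.2.removeNth_or i)]
  rfl

theorem chainMap_id (G : DirGraph.{u}) (k ℓ : ℕ) : chainMap R (𝟙 G) k ℓ = LinearMap.id := by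
  refine Finsupp.lhom_ext' fun x => LinearMap.ext_ring ?_
  simp only [LinearMap.comp_apply, Finsupp.lsingle_apply, LinearMap.id_apply]
  rw [chainMap_single, vmap_id, Function.id_comp, chain_of_isGen R x.2]

theorem chainMap_comp (f : G ⟶ H) (g : H ⟶ K) (k ℓ : ℕ) :
    chainMap R (f ≫ g) k ℓ = chainMap R g k ℓ ∘ₗ chainMap R f k ℓ := by
  refine Finsupp.lhom_ext' fun x => LinearMap.ext_ring ?_
  simp only [LinearMap.comp_apply, Finsupp.lsingle_apply]
  rw [chainMap_single, chainMap_single, chainMap_chain R g (x.2.map_or f)]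
  rfl

/-- The magnitude chain complex `MC_{*, ℓ}(G)` of a directed graph, over the ground ring `R`. -/
noncomputable def magnitudeComplex (G : DirGraph.{u}) (ℓ : ℕ) :
    ChainComplex (ModuleCat.{max u v} R) ℕ :=
  ChainComplex.of (fun k => ModuleCat.of R (G.Gen k ℓ →₀ R))
    (fun k => ModuleCat.ofHom (boundary R G k ℓ))
    (fun k => by rw [← ModuleCat.ofHom_comp, boundary_comp_boundary]; rfl)

theorem magnitudeComplex_d (G : DirGraph.{u}) (k ℓ : ℕ) :
    (magnitudeComplex R G ℓ).d (k + 1) k = ModuleCat.ofHom (boundary R G k ℓ) :=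
  ChainComplex.of_d (fun k => ModuleCat.of R (G.Gen k ℓ →₀ R))
    (fun k => ModuleCat.ofHom (boundary R G k ℓ)) k

/-- The magnitude chains as a functor from directed graphs to chain complexes. -/
noncomputable def magnitudeChains (ℓ : ℕ) :
    DirGraph.{u} ⥤ ChainComplex (ModuleCat.{max u v} R) ℕ where
  obj G := magnitudeComplex R G ℓ
  map {G H} f :=
    { f := fun k => ModuleCat.ofHom (chainMap R f k ℓ)
      comm' := by
        rintro _ k rfl
        change ModuleCat.ofHom (chainMap R f (k + 1) ℓ) ≫ (magnitudeComplex R H ℓ).d (k + 1) k =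
          (magnitudeComplex R G ℓ).d (k + 1) k ≫ ModuleCat.ofHom (chainMap R f k ℓ)
        rw [magnitudeComplex_d, magnitudeComplex_d]
        exact (congrArg ModuleCat.ofHom (chainMap_comp_boundary R f k ℓ)).symm }
  map_id G := by
    refine HomologicalComplex.hom_ext _ _ fun k => ?_
    change ModuleCat.ofHom (chainMap R (𝟙 G) k ℓ) = _
    rw [chainMap_id]
    rfl
  map_comp f g := by
    refine HomologicalComplex.hom_ext _ _ fun k => ?_
    change ModuleCat.ofHom (chainMap R (f ≫ g) k ℓ) = _
    rw [chainMap_comp]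
    rfl

/-- Magnitude homology `MH_{k, ℓ}` with coefficients in `R`, the `k`-th homology of the magnitude
chains `MC_{*, ℓ}`, as a functor from directed graphs to `R`-modules. -/
noncomputable def magnitudeHomology (k ℓ : ℕ) : DirGraph.{u} ⥤ ModuleCat.{max u v} R :=
  magnitudeChains R ℓ ⋙ HomologicalComplex.homologyFunctor _ _ k

/-- The Mayer–Vietoris sequence `MH(A) ⟶ MH(X) ⊕ MH(Y) ⟶ MH(P)` in bidegree `(k, ℓ)` of a
commutative square, with maps `(i_*, -f_*)` and `(x, y) ↦ g_* x + j_* y`. -/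
noncomputable def mayerVietoris {A X Y P : DirGraph.{u}} {i : A ⟶ X} {f : A ⟶ Y} {g : X ⟶ P}
    {j : Y ⟶ P} (sq : CommSq i f g j) (k ℓ : ℕ) : ShortComplex (ModuleCat.{max u v} R) :=
  ShortComplex.mk
    (biprod.lift ((magnitudeHomology R k ℓ).map i) (-(magnitudeHomology R k ℓ).map f))
    (biprod.desc ((magnitudeHomology R k ℓ).map g) ((magnitudeHomology R k ℓ).map j))
    (by rw [biprod.lift_desc, Preadditive.neg_comp, ← Functor.map_comp, ← Functor.map_comp, sq.w,
          add_neg_cancel])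

end DirGraph

/-! The splitting is induced by chain maps. No path enters `A` from outside, so a face of the same
length of a tuple not contained in `A` is again not contained in `A`. Killing all such tuples is
therefore a chain map that retracts the chains of `X` onto those of `A`. The pushout `P` consists of
`Y` and the vertices of `X` outside `A`. No path returns to `Y`, and the distance from `y` to `g x`
is `d(y, f (p x)) + d(i (p x), x)` for a projection `p`. Hence `P` retracts onto `Y` in the same
way, compatibly with the retraction onto `A`, and `j` has a projection too.

It remains to find a chain map `s` from the chains of `P` to those of `X` that vanishes on `Y` and
satisfies, up to homotopy, `1 = i r + s g` on `X` and `1 = j r' + g s` on `P`, in the order of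
function composition. Put `q = i ∘ p`. The prism `∑ⱼ (-1)ʲ (q x₀, …, q xⱼ, xⱼ, …)` on tuples
starting in `A` is a homotopy from the identity to an endomorphism `projEnd`. The latter fixes the
tuples starting outside `A` and sends `(x₀, x₁, …)` with `x₀ ∈ A` to `(q x₀, q x₁, …)` plus the
prism on `(x₁, …)`. The extra prism appears because the differential always omits the deletion of
`x₀`, while the prism on that shorter tuple may still have length `ℓ`.

The projected tuple has length `ℓ` only if the whole tuple lies in `A`, so that term is `i r`. The
prism on `(x₁, …)` vanishes unless `x₁, x₂, …` lie outside `A`, and then it depends only on the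
image in `P`. So the remaining terms factor as `s g` (`projEnd_eq_left`). The same `s` serves the
projection of `P` to `Y` (`projEnd_eq_right`). That `s` is a chain map is `prismMap_comp_boundary`.
In homology the homotopies become the equations of a splitting. -/

namespace DirGraph

/-! ### Distances in a pushout -/

section MetricPushout

variable {A X Y P : DirGraph.{u}}

/-- Read backwards from its end, a path into `A` can never leave `A`, and its edges lift because `A`
is induced. -/
theorem IsCofibration.exists_hasPath {i : A ⟶ X} (hi : IsCofibration i) {n : ℕ} {x z : X.V}
    (h : X.HasPath n x z) {b : A.V} (hb : vmap i b = z) :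
    ∃ a, vmap i a = x ∧ A.HasPath n a b := by
  induction h with
  | nil x => exact ⟨b, hb, .nil b⟩
  | @cons n x y z e _ ih =>
    obtain ⟨a, rfl, ha⟩ := ih hb
    by_cases hx : x ∈ Set.range (vmap i)
    · obtain ⟨c, rfl⟩ := hx
      exact ⟨c, rfl, .cons ((hi.induced _ _).2 e) ha⟩
    · exact absurd e (hi.no_edge x a hx)

theorem dist_le_dist_of_forall_hasPath {G H : DirGraph.{u}} {x y : G.V} {x' y' : H.V}
    (h : ∀ n, G.HasPath n x y → H.HasPath n x' y') : H.dist x' y' ≤ G.dist x y :=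
  le_iInf₂ fun n hn => dist_le_of_hasPath (h n hn)

theorem dist_eq_top {G : DirGraph.{u}} {x y : G.V} (h : ∀ n, ¬ G.HasPath n x y) :
    G.dist x y = ⊤ := by
  by_contra hc
  obtain ⟨n, hn, -⟩ := exists_hasPath_of_dist_ne_top hc
  exact h n hn

/-- `i` is an isometric embedding onto a set of vertices which no path enters from outside. -/
structure IsInitialEmbedding (i : A ⟶ X) : Prop where
  dist_map : ∀ a b, X.dist (vmap i a) (vmap i b) = A.dist a b
  dist_eq_top : ∀ x a, x ∉ Set.range (vmap i) → X.dist x (vmap i a) = ⊤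

theorem IsCofibration.isInitialEmbedding {i : A ⟶ X} (hi : IsCofibration i) :
    IsInitialEmbedding i where
  dist_map a b := by
    refine le_antisymm (dist_map_le i a b) (dist_le_dist_of_forall_hasPath fun n hn => ?_)
    obtain ⟨c, hc, hp⟩ := hi.exists_hasPath hn rfl
    rwa [hi.injective hc] at hp
  dist_eq_top x a hx := DirGraph.dist_eq_top fun n hn => by
    obtain ⟨c, hc, -⟩ := hi.exists_hasPath hn rfl
    exact hx ⟨c, hc⟩

theorem IsInitialEmbedding.injective {i : A ⟶ X} (hi : IsInitialEmbedding i) :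
    Function.Injective (vmap i) := fun a b h => by
  apply eq_of_dist_eq_zero
  rw [← hi.dist_map, h, dist_self]

theorem IsInitialEmbedding.mem_range {i : A ⟶ X} (hi : IsInitialEmbedding i) {x z : X.V}
    (h : X.dist x z ≠ ⊤) (hz : z ∈ Set.range (vmap i)) : x ∈ Set.range (vmap i) := by
  by_contra hx
  obtain ⟨a, rfl⟩ := hz
  exact h (hi.dist_eq_top x a hx)

/-- `p` projects each vertex of `X` to `A`: all distances from `A` are attained through the
projection. -/
def IsProjection (i : A ⟶ X) (p : X.V → A.V) : Prop :=
  ∀ (x : X.V) (a : A.V),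
    X.dist (vmap i a) x = X.dist (vmap i a) (vmap i (p x)) + X.dist (vmap i (p x)) x

/-- Cofibrations provide projections only on the reach. Elsewhere every distance from `A` is
infinite, so any vertex of `A` will do. -/
theorem IsCofibration.exists_isProjection {i : A ⟶ X} (hi : IsCofibration i) [Nonempty A.V] :
    ∃ p : X.V → A.V, IsProjection i p := by
  refine ⟨fun x => Classical.epsilon fun p => ∀ a : A.V,
    X.dist (vmap i a) x = X.dist (vmap i a) (vmap i p) + X.dist (vmap i p) x, fun x => ?_⟩
  apply Classical.epsilon_spec (p := fun p => ∀ a : A.V,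
    X.dist (vmap i a) x = X.dist (vmap i a) (vmap i p) + X.dist (vmap i p) x)
  by_cases hx : x ∈ reach i
  · exact hi.exists_proj x hx
  · have htop : ∀ a, X.dist (vmap i a) x = ⊤ := fun a =>
      DirGraph.dist_eq_top fun n hn => hx ⟨a, n, hn⟩
    exact ⟨Classical.arbitrary _, fun a => by simp [htop]⟩

/-- The metric properties of the pushout of `i : A ⟶ X` along `f : A ⟶ Y`: its vertices are those
of `Y` together with those of `X` outside `A`. -/
structure IsMetricPushout (i : A ⟶ X) (f : A ⟶ Y) (g : X ⟶ P) (j : Y ⟶ P) : Prop where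
  comm : ∀ a, vmap g (vmap i a) = vmap j (vmap f a)
  isInitialEmbedding : IsInitialEmbedding j
  notMem_range : ∀ x ∉ Set.range (vmap i), vmap g x ∉ Set.range (vmap j)
  exists_eq : ∀ p ∉ Set.range (vmap j), ∃ x ∉ Set.range (vmap i), vmap g x = p
  dist_map : ∀ x ∉ Set.range (vmap i), ∀ x' ∉ Set.range (vmap i),
    P.dist (vmap g x) (vmap g x') = X.dist x x'
  dist_eq : ∀ y, ∀ x ∉ Set.range (vmap i),
    P.dist (vmap j y) (vmap g x) = ⨅ a, Y.dist y (vmap f a) + X.dist (vmap i a) x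

/-- The infimum over `a` is attained at `p x`: a path to `x` through `a` may be rerouted through `p
x` at no cost, and `f` does not increase the distance from `a` to `p x`. -/
theorem IsMetricPushout.dist_eq_of_isProjection {i : A ⟶ X} {f : A ⟶ Y} {g : X ⟶ P} {j : Y ⟶ P}
    (h : IsMetricPushout i f g j) (hi : IsInitialEmbedding i) {p : X.V → A.V}
    (hp : IsProjection i p) (y : Y.V)
    {x : X.V} (hx : x ∉ Set.range (vmap i)) :
    P.dist (vmap j y) (vmap g x) = Y.dist y (vmap f (p x)) + X.dist (vmap i (p x)) x := by
  rw [h.dist_eq y x hx]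
  refine le_antisymm (iInf_le _ (p x)) (le_iInf fun a => ?_)
  rw [hp x a, ← add_assoc]
  refine add_le_add_left ((dist_triangle _ (vmap f a) _).trans (add_le_add_right ?_ _)) _
  rw [hi.dist_map]
  exact dist_map_le f _ _

/-! ### The explicit model of the pushout -/

/-- The explicit pushout of `i : A ⟶ X` along `f : A ⟶ Y`. -/
def glue (i : A ⟶ X) (f : A ⟶ Y) : DirGraph.{u} where
  V := Y.V ⊕ {x : X.V // x ∉ Set.range (vmap i)}
  graph :=
    { Adj := fun
        | .inl y, .inl y' => Y.graph.Adj y y'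
        | .inr x, .inr x' => X.graph.Adj x x'
        | .inl y, .inr x => ∃ a, vmap f a = y ∧ X.graph.Adj (vmap i a) x
        | .inr _, .inl _ => False }

/-- The inclusion of `Y` in the explicit pushout. -/
def glueInl (i : A ⟶ X) (f : A ⟶ Y) : Y ⟶ glue i f :=
  Hom.mk (G := Y) (H := glue i f) Sum.inl fun _ _ h => Or.inr h

open Classical in
/-- The function on vertices underlying the map from `X` to the explicit pushout. -/
noncomputable def glueFun (i : A ⟶ X) (f : A ⟶ Y) (x : X.V) : (glue i f).V :=
  if h : ∃ a, vmap i a = x then Sum.inl (vmap f h.choose) else Sum.inr ⟨x, h⟩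

theorem glueFun_of_notMem (i : A ⟶ X) (f : A ⟶ Y) {x : X.V} (h : x ∉ Set.range (vmap i)) :
    glueFun i f x = Sum.inr ⟨x, h⟩ := dif_neg h

theorem glueFun_vmap {i : A ⟶ X} (hi : IsCofibration i) (f : A ⟶ Y) (a : A.V) :
    glueFun i f (vmap i a) = Sum.inl (vmap f a) := by
  have h : ∃ b, vmap i b = vmap i a := ⟨a, rfl⟩
  exact (dif_pos h).trans (congrArg (fun b => Sum.inl (vmap f b)) (hi.injective h.choose_spec))

/-- The map from `X` to the explicit pushout. -/
noncomputable def glueMap {i : A ⟶ X} (hi : IsCofibration i) (f : A ⟶ Y) : X ⟶ glue i f :=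
  Hom.mk (G := X) (H := glue i f) (glueFun i f) fun x x' h => by
    by_cases hx : x ∈ Set.range (vmap i)
    · obtain ⟨a, rfl⟩ := hx
      rw [glueFun_vmap hi]
      by_cases hx' : x' ∈ Set.range (vmap i)
      · obtain ⟨b, rfl⟩ := hx'
        rw [glueFun_vmap hi]
        exact (vmap_adj f ((hi.induced a b).2 h)).imp (congrArg _) id
      · rw [glueFun_of_notMem i f hx']
        exact Or.inr ⟨a, rfl, h⟩
    · by_cases hx' : x' ∈ Set.range (vmap i)
      · obtain ⟨b, rfl⟩ := hx'
        exact absurd h (hi.no_edge x b hx)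
      · rw [glueFun_of_notMem i f hx, glueFun_of_notMem i f hx']
        exact Or.inr h

theorem vmap_glueMap {i : A ⟶ X} (hi : IsCofibration i) (f : A ⟶ Y) :
    vmap (glueMap hi f) = glueFun i f := rfl

theorem hom_ext {G H : DirGraph.{u}} {f g : G ⟶ H} (h : vmap f = vmap g) : f = g :=
  Hom.ext h

theorem isPushout_glue {i : A ⟶ X} (hi : IsCofibration i) (f : A ⟶ Y) :
    IsPushout i f (glueMap hi f) (glueInl i f) where
  w := hom_ext <| funext fun a => glueFun_vmap hi f a
  isColimit' := by
    refine ⟨PushoutCocone.IsColimit.mk _ (fun s => ?_) (fun s => ?_) (fun s => ?_) ?_⟩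
    · refine Hom.mk (G := glue i f) (H := s.pt)
        (Sum.elim (vmap s.inr) fun x => vmap s.inl x.1) ?_
      have hw : ∀ a, vmap s.inl (vmap i a) = vmap s.inr (vmap f a) := fun a =>
        congrFun (congrArg vmap s.condition) a
      rintro (y | x) (y' | x') h
      · exact vmap_adj s.inr h
      · obtain ⟨a, rfl, h⟩ := h
        have := vmap_adj s.inl h
        rw [hw] at this
        exact this
      · exact h.elim
      · exact vmap_adj s.inl (x := x.1) (y := x'.1) h
    · refine hom_ext (funext fun x => ?_)
      rw [vmap_comp, Function.comp_apply, vmap_glueMap]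
      by_cases hx : x ∈ Set.range (vmap i)
      · obtain ⟨a, rfl⟩ := hx
        rw [glueFun_vmap hi]
        exact (congrFun (congrArg vmap s.condition) a).symm
      · rw [glueFun_of_notMem i f hx]
        rfl
    · rfl
    · intro s m h₁ h₂
      refine hom_ext (funext fun z => ?_)
      rcases z with y | x
      · exact congrFun (congrArg vmap h₂) y
      · have := congrFun (congrArg vmap h₁) x.1
        rw [vmap_comp, Function.comp_apply, vmap_glueMap, glueFun_of_notMem i f x.2] at this
        exact this

/-- A path cannot return from `X ∖ A` to `Y`, so it crosses at most once. The crossing edge is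
counted as an edge of `X` leaving `i a`. -/
theorem hasPath_glue {i : A ⟶ X} {f : A ⟶ Y} {n : ℕ} {p q : (glue i f).V}
    (h : (glue i f).HasPath n p q) :
    match p, q with
    | .inl y, .inl y' => Y.HasPath n y y'
    | .inr x, .inr x' => X.HasPath n x x'
    | .inl y, .inr x => ∃ (a : A.V) (m m' : ℕ), m + m' = n ∧ Y.HasPath m y (vmap f a) ∧
        X.HasPath m' (vmap i a) x
    | .inr _, .inl _ => False := by
  induction h with
  | nil p => rcases p with y | x <;> exact .nil _
  | @cons n p r q e _ ih =>
    rcases p with y | x <;> rcases r with y' | x' <;> rcases q with y'' | x''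
    · exact .cons e ih
    · obtain ⟨a, m, m', rfl, h, h'⟩ := ih
      exact ⟨a, m + 1, m', by omega, .cons e h, h'⟩
    · exact ih.elim
    · obtain ⟨a, rfl, e⟩ := e
      exact ⟨a, 0, n + 1, by omega, .nil _, .cons e ih⟩
    · exact e.elim
    · exact e.elim
    · exact ih
    · exact .cons e ih

theorem isMetricPushout_glue {i : A ⟶ X} (hi : IsCofibration i) (f : A ⟶ Y) :
    IsMetricPushout i f (glueMap hi f) (glueInl i f) where
  comm a := glueFun_vmap hi f a
  isInitialEmbedding :=
    { dist_map := fun y y' => le_antisymm (dist_map_le _ _ _)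
        (dist_le_dist_of_forall_hasPath fun n hn => hasPath_glue hn)
      dist_eq_top := by
        rintro (y | x) y' h
        · exact absurd ⟨y, rfl⟩ h
        · exact DirGraph.dist_eq_top fun n hn => hasPath_glue hn }
  notMem_range x hx := by
    rw [vmap_glueMap, glueFun_of_notMem i f hx]
    rintro ⟨y, hy⟩
    cases hy
  exists_eq := by
    rintro (y | x) h
    · exact absurd ⟨y, rfl⟩ h
    · exact ⟨x.1, x.2, glueFun_of_notMem i f x.2⟩
  dist_map x hx x' hx' := by
    refine le_antisymm (dist_map_le _ _ _) (dist_le_dist_of_forall_hasPath fun n hn => ?_)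
    rw [vmap_glueMap, glueFun_of_notMem i f hx, glueFun_of_notMem i f hx'] at hn
    exact hasPath_glue hn
  dist_eq y x hx := by
    refine le_antisymm (le_iInf fun a => ?_) (le_iInf₂ fun n hn => ?_)
    · refine (dist_triangle _ (vmap (glueInl i f) (vmap f a)) _).trans
        (add_le_add (dist_map_le _ _ _) ?_)
      have : vmap (glueInl i f) (vmap f a) = vmap (glueMap hi f) (vmap i a) :=
        (glueFun_vmap hi f a).symm
      rw [this]
      exact dist_map_le _ _ _
    · rw [vmap_glueMap, glueFun_of_notMem i f hx] at hn
      obtain ⟨a, m, m', rfl, h, h'⟩ := hasPath_glue hn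
      refine (iInf_le _ a).trans ?_
      push_cast
      exact add_le_add (dist_le_of_hasPath h) (dist_le_of_hasPath h')

/-! ### Transport to an arbitrary pushout -/

theorem dist_map_iso {G H : DirGraph.{u}} (e : G ≅ H) (x y : G.V) :
    H.dist (vmap e.hom x) (vmap e.hom y) = G.dist x y := by
  refine le_antisymm (dist_map_le _ _ _) ?_
  have h : ∀ z, vmap e.inv (vmap e.hom z) = z := congrFun (congrArg vmap e.hom_inv_id)
  simpa only [h] using dist_map_le e.inv (vmap e.hom x) (vmap e.hom y)

theorem IsMetricPushout.of_iso {P' : DirGraph.{u}} {i : A ⟶ X} {f : A ⟶ Y} {g : X ⟶ P}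
    {j : Y ⟶ P} (h : IsMetricPushout i f g j) (e : P ≅ P') :
    IsMetricPushout i f (g ≫ e.hom) (j ≫ e.hom) := by
  have h1 : ∀ z, vmap e.inv (vmap e.hom z) = z := congrFun (congrArg vmap e.hom_inv_id)
  have h2 : ∀ z, vmap e.hom (vmap e.inv z) = z := congrFun (congrArg vmap e.inv_hom_id)
  have hinj : Function.Injective (vmap e.hom) := Function.LeftInverse.injective h1
  have hr : ∀ z, vmap e.hom z ∈ Set.range (vmap (j ≫ e.hom)) ↔ z ∈ Set.range (vmap j) := fun z =>
    ⟨fun ⟨y, hy⟩ => ⟨y, hinj hy⟩, fun ⟨y, hy⟩ => ⟨y, congrArg (vmap e.hom) hy⟩⟩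
  constructor
  · exact fun a => congrArg (vmap e.hom) (h.comm a)
  · constructor
    · intro a b
      exact (dist_map_iso e _ _).trans (h.isInitialEmbedding.dist_map a b)
    · intro x a hx
      rw [← h2 x, hr] at hx
      rw [← h2 x]
      exact (dist_map_iso e _ _).trans (h.isInitialEmbedding.dist_eq_top _ a hx)
  · exact fun x hx => (hr _).not.2 (h.notMem_range x hx)
  · intro p hp
    rw [← h2 p, hr] at hp
    obtain ⟨x, hx, hxp⟩ := h.exists_eq _ hp
    exact ⟨x, hx, (congrArg (vmap e.hom) hxp).trans (h2 p)⟩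
  · exact fun x hx x' hx' => (dist_map_iso e _ _).trans (h.dist_map x hx x' hx')
  · exact fun y x hx => (dist_map_iso e _ _).trans (h.dist_eq y x hx)

theorem IsCofibration.isMetricPushout {i : A ⟶ X} (hi : IsCofibration i) {f : A ⟶ Y} {g : X ⟶ P}
    {j : Y ⟶ P} (hP : IsPushout i f g j) : IsMetricPushout i f g j := by
  have hQ := isPushout_glue hi f
  have := (isMetricPushout_glue hi f).of_iso (hQ.isoIsPushout _ _ hP)
  rwa [hQ.inl_isoIsPushout_hom, hQ.inr_isoIsPushout_hom] at this

end MetricPushout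

/-! ### The prism operator -/

section PrismTuple

variable {α : Type*} (q : α → α)

/-- The tuple `(q v₀, …, q vⱼ, vⱼ, …)`. -/
def prismTuple {n : ℕ} (j : Fin n) (v : Fin n → α) : Fin (n + 1) → α := fun m =>
  if m ≤ j.castSucc then q (v (j.predAbove m)) else v (j.predAbove m)

/-- The tuple `(q v₀, …, q vⱼ₋₁, vⱼ, …)`. -/
def prismFace {n : ℕ} (j : Fin (n + 1)) (v : Fin n → α) : Fin n → α := fun m =>
  if m.castSucc < j then q (v m) else v m

theorem prismFace_zero {n : ℕ} (v : Fin n → α) : prismFace q 0 v = v := by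
  funext m
  simp [prismFace]

theorem prismFace_last {n : ℕ} (v : Fin n → α) : prismFace q (Fin.last n) v = q ∘ v := by
  funext m
  simp [prismFace, Fin.castSucc_lt_last]

theorem prismTuple_apply_zero {n : ℕ} (j : Fin (n + 1)) (v : Fin (n + 1) → α) :
    prismTuple q j v 0 = q (v 0) := by
  simp [prismTuple]

theorem tail_prismTuple_zero {n : ℕ} (v : Fin (n + 1) → α) :
    Fin.tail (prismTuple q 0 v) = v := by
  funext m
  simp [prismTuple, Fin.tail]

theorem tail_prismTuple_succ {n : ℕ} (j : Fin n) (v : Fin (n + 1) → α) :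
    Fin.tail (prismTuple q j.succ v) = prismTuple q j (Fin.tail v) := by
  funext m
  simp only [prismTuple, Fin.tail, ← Fin.succ_castSucc, Fin.succ_le_succ_iff,
    Fin.succ_predAbove_succ]

theorem comp_prismTuple {β : Type*} {q' : β → β} {φ : α → β} {n : ℕ} (j : Fin n) (v : Fin n → α)
    (h : ∀ m, φ (q (v m)) = q' (φ (v m))) :
    φ ∘ prismTuple q j v = prismTuple q' j (φ ∘ v) := by
  funext m
  simp only [prismTuple, Function.comp_apply, apply_ite φ, h]

/-- Positions `j` and `j + 1` hold `q vⱼ` and `vⱼ`. Deleting `vⱼ` here gives the same tuple as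
deleting `q vⱼ₊₁` from the next prism tuple, so these faces telescope. -/
theorem removeNth_castSucc_prismTuple {n : ℕ} (j : Fin n) (v : Fin n → α) :
    j.castSucc.removeNth (prismTuple q j v) = prismFace q j.castSucc v := by
  funext t
  simp only [Fin.removeNth, prismTuple, prismFace]
  rcases lt_or_ge t j with h | h
  · rw [Fin.succAbove_of_castSucc_lt _ _ (Fin.castSucc_lt_castSucc_iff.2 h),
      if_pos (Fin.castSucc_le_castSucc_iff.2 h.le), if_pos (Fin.castSucc_lt_castSucc_iff.2 h),
      Fin.predAbove_castSucc_of_le _ _ h.le]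
  · rw [Fin.succAbove_of_le_castSucc _ _ (Fin.castSucc_le_castSucc_iff.2 h),
      if_neg (not_le.2 (Fin.castSucc_lt_succ_iff.2 h)),
      if_neg (not_lt.2 (Fin.castSucc_le_castSucc_iff.2 h)), Fin.predAbove_succ_of_le _ _ h]

theorem removeNth_succ_prismTuple {n : ℕ} (j : Fin n) (v : Fin n → α) :
    j.succ.removeNth (prismTuple q j v) = prismFace q j.succ v := by
  funext t
  simp only [Fin.removeNth, prismTuple, prismFace]
  rcases le_or_gt t j with h | h
  · rw [Fin.succAbove_of_castSucc_lt _ _ (Fin.castSucc_lt_succ_iff.2 h),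
      if_pos (Fin.castSucc_le_castSucc_iff.2 h), if_pos (Fin.castSucc_lt_succ_iff.2 h),
      Fin.predAbove_castSucc_of_le _ _ h]
  · rw [Fin.succAbove_of_le_castSucc _ _ (Fin.succ_le_castSucc_iff.2 h),
      if_neg (not_le.2 (Fin.castSucc_lt_succ_iff.2 h.le)),
      if_neg (not_lt.2 (Fin.succ_le_castSucc_iff.2 h)), Fin.predAbove_succ_of_le _ _ h.le]

theorem val_succAbove_eq_ite {n : ℕ} (p : Fin (n + 1)) (i : Fin n) :
    (p.succAbove i : ℕ) = if (i : ℕ) < p then (i : ℕ) else i + 1 := by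
  rcases lt_or_ge i.castSucc p with h | h
  · rw [Fin.succAbove_of_castSucc_lt _ _ h, if_pos (by exact h), Fin.val_castSucc]
  · rw [Fin.succAbove_of_le_castSucc _ _ h, if_neg (not_lt.2 (by exact h)), Fin.val_succ]

theorem val_predAbove_eq_ite {n : ℕ} (p : Fin n) (i : Fin (n + 1)) :
    (p.predAbove i : ℕ) = if (p : ℕ) < i then (i : ℕ) - 1 else i := by
  rcases lt_or_ge p.castSucc i with h | h
  · rw [Fin.predAbove_of_castSucc_lt _ _ h, if_pos (by exact h), Fin.val_pred]
  · rw [Fin.predAbove_of_le_castSucc _ _ h, if_neg (not_lt.2 (by exact h)), Fin.coe_castPred]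

/-- The index `j.castSucc.succAbove (j.succAbove m)` runs over the positions other than `j` and `j +
1`. These faces are prism tuples on faces of `v`. -/
theorem removeNth_succAbove_prismTuple {n : ℕ} (j : Fin (n + 1)) (m : Fin n)
    (v : Fin (n + 1) → α) :
    (j.castSucc.succAbove (j.succAbove m)).removeNth (prismTuple q j v) =
      prismTuple q (m.predAbove j) ((j.succAbove m).removeNth v) := by
  funext t
  simp only [Fin.removeNth, prismTuple]
  have h1 : (j.castSucc.succAbove (j.succAbove m)).succAbove t ≤ j.castSucc ↔
      t ≤ (m.predAbove j).castSucc := by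
    simp only [Fin.le_def, val_succAbove_eq_ite, val_predAbove_eq_ite, Fin.val_castSucc]
    split_ifs <;> omega
  have h2 : j.predAbove ((j.castSucc.succAbove (j.succAbove m)).succAbove t) =
      (j.succAbove m).succAbove ((m.predAbove j).predAbove t) := by
    apply Fin.ext
    simp only [val_succAbove_eq_ite, val_predAbove_eq_ite, Fin.val_castSucc]
    split_ifs <;> omega
  simp only [h1, h2]

theorem removeNth_removeNth_ne {k : ℕ} {x : Fin (k + 2) → α} {i : Fin (k + 1)}
    (hi : x i.castSucc = x i.succ) {m : Fin (k + 2)} (h1 : m ≠ i.castSucc) (h2 : m ≠ i.succ) :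
    ∃ t : Fin k, m.removeNth x t.castSucc = m.removeNth x t.succ := by
  simp only [Fin.removeNth]
  rcases lt_or_gt_of_ne h1 with h | h
  · have h' : (m : ℕ) < i := h
    refine ⟨⟨i - 1, by omega⟩, ?_⟩
    convert hi using 2 <;> apply Fin.ext
    · rw [Fin.succAbove_of_le_castSucc _ _ (by simp [Fin.le_def]; omega)]
      simp; omega
    · rw [Fin.succAbove_of_le_castSucc _ _ (by simp [Fin.le_def]; omega)]
      simp; omega
  · have h' : (i : ℕ) < m := h
    have h'' : (m : ℕ) ≠ i + 1 := fun e => h2 (Fin.ext e)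
    refine ⟨⟨i, by omega⟩, ?_⟩
    convert hi using 2 <;> apply Fin.ext
    · rw [Fin.succAbove_of_castSucc_lt _ _ (by simp [Fin.lt_def]; omega)]
      simp
    · rw [Fin.succAbove_of_castSucc_lt _ _ (by simp [Fin.lt_def]; omega)]
      simp

theorem removeNth_castSucc_eq_removeNth_succ {k : ℕ} {x : Fin (k + 2) → α} {i : Fin (k + 1)}
    (hi : x i.castSucc = x i.succ) : i.castSucc.removeNth x = i.succ.removeNth x := by
  funext t
  simp only [Fin.removeNth]
  rcases lt_trichotomy t i with h | rfl | h
  · rw [Fin.succAbove_of_castSucc_lt _ _ (Fin.castSucc_lt_castSucc_iff.2 h),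
      Fin.succAbove_of_castSucc_lt _ _ (Fin.castSucc_lt_succ_iff.2 h.le)]
  · rw [Fin.succAbove_castSucc_self, Fin.succAbove_succ_self, hi]
  · rw [Fin.succAbove_of_le_castSucc _ _ (Fin.castSucc_le_castSucc_iff.2 h.le),
      Fin.succAbove_of_le_castSucc _ _ (Fin.succ_le_castSucc_iff.2 h)]

end PrismTuple

/-- The formula for the boundary of a prism, with the geometry removed. `U` collects the faces
shared by neighbouring tuples, which telescope. The other faces are reindexed by the swap `(j, m) ↦
(j.succAbove m, m.predAbove j)`, which reverses the sign. -/
theorem sum_prism (R : Type v) [CommRing R] {M : Type*} [AddCommGroup M] [Module R M] {k : ℕ}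
    (F : Fin (k + 1) → Fin (k + 2) → M) (U : Fin (k + 2) → M) (S : Fin (k + 1) → Fin k → M)
    (h1 : ∀ j, F j j.castSucc = U j.castSucc) (h2 : ∀ j, F j j.succ = U j.succ)
    (h3 : ∀ j m, F j (j.castSucc.succAbove (j.succAbove m)) =
      S (j.succAbove m) (m.predAbove j)) :
    ∑ j : Fin (k + 1), (-1 : R) ^ (j : ℕ) • ∑ m : Fin (k + 2), (-1 : R) ^ (m : ℕ) • F j m =
      U 0 - U (Fin.last _) -
        ∑ m : Fin (k + 1), (-1 : R) ^ (m : ℕ) • ∑ j : Fin k, (-1 : R) ^ (j : ℕ) • S m j := by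
  -- Skipping the adjacent positions `j` and `j + 1` shifts `m` by `0` or `2`, so its parity is
  -- unchanged.
  have hsign : ∀ (j : Fin (k + 1)) (m : Fin k),
      (-1 : R) ^ ((j.castSucc.succAbove (j.succAbove m) : Fin (k + 2)) : ℕ) =
        (-1) ^ (m : ℕ) := by
    intro j m
    rcases lt_or_ge m.castSucc j with h | h
    · rw [Fin.succAbove_of_castSucc_lt _ _ h,
        Fin.succAbove_of_castSucc_lt _ _ (Fin.castSucc_lt_castSucc_iff.2 h)]
      rfl
    · rw [Fin.succAbove_of_le_castSucc _ _ h, Fin.succAbove_of_le_castSucc]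
      · simp [pow_succ]
      · exact Fin.castSucc_le_castSucc_iff.2 (h.trans (Fin.castSucc_lt_succ).le)
  have hinner : ∀ j : Fin (k + 1),
      (-1 : R) ^ (j : ℕ) • ∑ m : Fin (k + 2), (-1 : R) ^ (m : ℕ) • F j m =
        U j.castSucc - U j.succ + ∑ m : Fin k, (-1 : R) ^ ((j : ℕ) + m) •
          S (j.succAbove m) (m.predAbove j) := by
    intro j
    have hsq : (-1 : R) ^ (j : ℕ) * (-1) ^ (j : ℕ) = 1 := by
      rw [← mul_pow]; simp
    rw [Fin.sum_univ_succAbove _ j.castSucc, Fin.sum_univ_succAbove _ j,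
      Fin.succAbove_castSucc_self, h1, h2]
    simp only [hsign, h3, smul_add, Finset.smul_sum, smul_smul, Fin.val_castSucc, Fin.val_succ,
      pow_succ, ← pow_add]
    rw [← add_assoc]
    congr 1
    rw [pow_add, mul_neg_one, mul_neg, hsq, one_smul, neg_smul, one_smul, sub_eq_add_neg]
  have htel : ∑ j : Fin (k + 1), (U j.castSucc - U j.succ) = U 0 - U (Fin.last _) := by
    have := (Fin.sum_univ_succ U).symm.trans (Fin.sum_univ_castSucc U)
    rw [Finset.sum_sub_distrib, sub_eq_sub_iff_add_eq_add, ← this]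
  rw [Finset.sum_congr rfl fun j _ => hinner j, Finset.sum_add_distrib, htel,
    sub_eq_add_neg (U 0 - U (Fin.last (k + 1)))]
  congr 1
  simp only [Finset.smul_sum, smul_smul, ← pow_add]
  rw [← Finset.sum_product', ← Finset.sum_product', Finset.univ_product_univ,
    ← Finset.sum_neg_distrib]
  refine Finset.sum_bij' (fun p _ => (p.1.succAbove p.2, p.2.predAbove p.1))
    (fun p _ => (p.1.succAbove p.2, p.2.predAbove p.1)) ?_ ?_ ?_ ?_ ?_
  · exact fun _ _ => Finset.mem_univ _
  · exact fun _ _ => Finset.mem_univ _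
  · rintro ⟨i, j⟩ _
    exact Prod.ext (Fin.succAbove_succAbove_predAbove i j) (Fin.predAbove_predAbove_succAbove i j)
  · rintro ⟨i, j⟩ _
    exact Prod.ext (Fin.succAbove_succAbove_predAbove i j) (Fin.predAbove_predAbove_succAbove i j)
  · rintro ⟨i, j⟩ _
    dsimp only
    rw [Fin.neg_one_pow_succAbove_add_predAbove, neg_smul, neg_neg]

/-! ### Lengths of prism tuples and the boundary of a prism -/

variable {G H : DirGraph.{u}}

/-- By `hq`, the passage from the projected to the original entries can be moved one step towards
the front without shortening the tuple. Repeating this brings it to the first entry. -/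
theorem length_prismTuple_le {q : G.V → G.V}
    (hq : ∀ a b, G.dist (q a) (q b) + G.dist (q b) b ≤ G.dist (q a) a + G.dist a b) {k : ℕ}
    (j : Fin (k + 1)) (v : Fin (k + 1) → G.V) :
    G.length (prismTuple q j v) ≤ G.dist (q (v 0)) (v 0) + G.length v := by
  induction k with
  | zero =>
    obtain rfl : j = 0 := Fin.fin_one_eq_zero j
    rw [length_succ, tail_prismTuple_zero, prismTuple_apply_zero]
    rfl
  | succ k ih =>
    have h1 : prismTuple q j v 1 = Fin.tail (prismTuple q j v) 0 := rfl
    cases j using Fin.cases with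
    | zero => rw [length_succ, h1, tail_prismTuple_zero, prismTuple_apply_zero]
    | succ j =>
      rw [length_succ, h1, tail_prismTuple_succ, prismTuple_apply_zero, prismTuple_apply_zero,
        length_succ v]
      refine (add_le_add_right (ih j (Fin.tail v)) _).trans ?_
      rw [← add_assoc, ← add_assoc]
      exact add_le_add_left (hq _ _) _

/-- The same exchange with the passage at the very end. It shows that a projected tuple is strictly
shorter once its last entry moves. -/
theorem length_comp_add_dist_le {q : G.V → G.V}
    (hq : ∀ a b, G.dist (q a) (q b) + G.dist (q b) b ≤ G.dist (q a) a + G.dist a b) {k : ℕ}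
    (v : Fin (k + 1) → G.V) :
    G.length (q ∘ v) + G.dist (q (v (Fin.last k))) (v (Fin.last k)) ≤
      G.dist (q (v 0)) (v 0) + G.length v := by
  induction k with
  | zero => simp [length]
  | succ k ih =>
    rw [length_succ, length_succ v, add_assoc]
    refine (add_le_add_right (ih (Fin.tail v)) _).trans ?_
    rw [← add_assoc, ← add_assoc]
    exact add_le_add_left (hq _ _) _

variable (R : Type v) [CommRing R]

theorem chain_of_lt {k ℓ : ℕ} {x : Fin (k + 1) → G.V} (h : G.length x < ℓ) :
    chain R G k ℓ x = 0 :=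
  chain_of_not_isGen R fun h' => h.ne h'.2

theorem exists_eq_of_not_isGen {k ℓ : ℕ} {x : Fin (k + 1) → G.V} (h : ¬ G.IsGen k ℓ x)
    (hx : G.length x ≤ ℓ) : G.length x < ℓ ∨ ∃ i : Fin k, x i.castSucc = x i.succ := by
  by_contra hc
  push Not at hc
  exact h ⟨hc.2, le_antisymm hx hc.1⟩

/-- Prism tuples may repeat an entry while having length `ℓ`, and then represent `0`. Their faces
still sum to zero: the two deletions at the repetition cancel, and every other face keeps a
repetition. -/
theorem boundary_chain_of_le {k ℓ : ℕ} {x : Fin (k + 2) → G.V} (hx : G.length x ≤ ℓ) :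
    boundary R G k ℓ (chain R G (k + 1) ℓ x) =
      ∑ i : Fin (k + 2), (-1 : R) ^ (i : ℕ) • chain R G k ℓ (i.removeNth x) := by
  by_cases h : G.IsGen (k + 1) ℓ x
  · exact boundary_chain R (Or.inl h)
  rcases exists_eq_of_not_isGen h hx with hlt | ⟨i, hi⟩
  · exact boundary_chain R (Or.inr hlt)
  · rw [chain_of_not_isGen R h, map_zero,
      Finset.sum_eq_add i.castSucc i.succ (Fin.castSucc_lt_succ).ne]
    · rw [removeNth_castSucc_eq_removeNth_succ hi, Fin.val_castSucc, Fin.val_succ, pow_succ,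
        mul_neg_one, neg_smul, add_neg_cancel]
    · rintro m - ⟨h1, h2⟩
      obtain ⟨t, ht⟩ := removeNth_removeNth_ne hi h1 h2
      rw [chain_of_not_isGen R fun h' => h'.1 t ht, smul_zero]
    · exact fun h => absurd (Finset.mem_univ _) h
    · exact fun h => absurd (Finset.mem_univ _) h

theorem chainMap_chain_of_le {k ℓ : ℕ} (f : G ⟶ H) {x : Fin (k + 1) → G.V}
    (hx : G.length x ≤ ℓ) :
    chainMap R f k ℓ (chain R G k ℓ x) = chain R H k ℓ (vmap f ∘ x) := by
  by_cases h : G.IsGen k ℓ x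
  · exact chainMap_chain R f (Or.inl h)
  rcases exists_eq_of_not_isGen h hx with hlt | ⟨i, hi⟩
  · exact chainMap_chain R f (Or.inr hlt)
  · rw [chain_of_not_isGen R h, map_zero,
      chain_of_not_isGen R fun h' => h'.1 i (congrArg (vmap f) hi)]

/-- The chain `∑ⱼ (-1)ʲ (q v₀, …, q vⱼ, vⱼ, …)`. -/
noncomputable def prism (q : G.V → G.V) (n ℓ : ℕ) (v : Fin n → G.V) : G.Gen n ℓ →₀ R :=
  ∑ j : Fin n, (-1 : R) ^ (j : ℕ) • chain R G n ℓ (prismTuple q j v)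

theorem prism_zero (q : G.V → G.V) (ℓ : ℕ) (v : Fin 0 → G.V) : prism R q 0 ℓ v = 0 := rfl

theorem prism_of_lt {q : G.V → G.V}
    (hq : ∀ a b, G.dist (q a) (q b) + G.dist (q b) b ≤ G.dist (q a) a + G.dist a b) {k ℓ : ℕ}
    {v : Fin (k + 1) → G.V} (hv : G.dist (q (v 0)) (v 0) + G.length v < ℓ) :
    prism R q (k + 1) ℓ v = 0 :=
  Finset.sum_eq_zero fun j _ => by
    rw [chain_of_lt R ((length_prismTuple_le hq j v).trans_lt hv), smul_zero]

/-- The final sum runs over all deletions from `v`, including those that shorten `v` and so are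
omitted by the differential. -/
theorem boundary_prism {q : G.V → G.V}
    (hq : ∀ a b, G.dist (q a) (q b) + G.dist (q b) b ≤ G.dist (q a) a + G.dist a b) {k ℓ : ℕ}
    {v : Fin (k + 1) → G.V} (hv : G.dist (q (v 0)) (v 0) + G.length v ≤ ℓ) :
    boundary R G k ℓ (prism R q (k + 1) ℓ v) =
      chain R G k ℓ v - chain R G k ℓ (q ∘ v) -
        ∑ m : Fin (k + 1), (-1 : R) ^ (m : ℕ) • prism R q k ℓ (m.removeNth v) := by
  rw [prism, map_sum]
  simp only [map_smul,
    fun j => boundary_chain_of_le R ((length_prismTuple_le hq j v).trans hv)]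
  rw [sum_prism R _ (fun j => chain R G k ℓ (prismFace q j v))
    (fun m j => chain R G k ℓ (prismTuple q j (m.removeNth v)))]
  · rw [prismFace_zero, prismFace_last]
    rfl
  · exact fun j => by rw [removeNth_castSucc_prismTuple]
  · exact fun j => by rw [removeNth_succ_prismTuple]
  · exact fun j m => by rw [removeNth_succAbove_prismTuple]

/-! ### Generators and their faces -/

section Generators

theorem IsGen.dist_ne_top {k ℓ : ℕ} {x : Fin (k + 1) → G.V} (hx : G.IsGen k ℓ x) (t : Fin k) :
    G.dist (x t.castSucc) (x t.succ) ≠ ⊤ := by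
  have h : G.length x ≠ ⊤ := by simp [hx.2]
  intro ht
  apply h
  unfold length
  rw [← Finset.add_sum_erase _ _ (Finset.mem_univ t), ht, top_add]

/-- The first step is positive and the rest finite. Hence the differential always omits the deletion
of the first entry. -/
theorem IsGen.length_tail_lt {k ℓ : ℕ} {x : Fin (k + 2) → G.V} (hx : G.IsGen (k + 1) ℓ x) :
    G.length (Fin.tail x) < ℓ := by
  rw [← hx.2, length_succ]
  refine ENat.lt_add_left ?_ (pos_iff_ne_zero.2 fun h => hx.1 0 (eq_of_dist_eq_zero h))
  intro h
  have := hx.2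
  rw [length_succ, h, add_top] at this
  simp at this

theorem length_eq_init {k : ℕ} (x : Fin (k + 2) → G.V) :
    G.length x = G.length (Fin.init x) +
      G.dist (x (Fin.last k).castSucc) (x (Fin.last (k + 1))) := by
  simp [length, Fin.sum_univ_castSucc, Fin.init]

theorem IsGen.length_init_lt {k ℓ : ℕ} {x : Fin (k + 2) → G.V} (hx : G.IsGen (k + 1) ℓ x) :
    G.length (Fin.init x) < ℓ := by
  rw [← hx.2, length_eq_init, add_comm (G.length _)]
  refine ENat.lt_add_left ?_
    (pos_iff_ne_zero.2 fun h => hx.1 (Fin.last k) (eq_of_dist_eq_zero h))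
  intro h
  have := hx.2
  rw [length_eq_init, h, top_add] at this
  simp at this

theorem removeNth_last_eq_init {α : Type*} {k : ℕ} (x : Fin (k + 1) → α) :
    (Fin.last k).removeNth x = Fin.init x := by
  funext t
  simp [Fin.removeNth, Fin.init]

theorem IsGen.forall_mem {k ℓ : ℕ} {x : Fin (k + 1) → G.V} (hx : G.IsGen k ℓ x) {S : Set G.V}
    (hS : ∀ a b, G.dist a b ≠ ⊤ → a ∈ S → b ∈ S) (h0 : x 0 ∈ S) (t : Fin (k + 1)) : x t ∈ S := by
  induction t using Fin.induction with
  | zero => exact h0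
  | succ t ih => exact hS _ _ (hx.dist_ne_top t) ih

theorem length_map_eq (h : H ⟶ G) {S : Set H.V}
    (hd : ∀ a ∈ S, ∀ b ∈ S, G.dist (vmap h a) (vmap h b) = H.dist a b) {k : ℕ}
    {y : Fin (k + 1) → H.V} (hy : ∀ m, y m ∈ S) : G.length (vmap h ∘ y) = H.length y :=
  Finset.sum_congr rfl fun _ _ => hd _ (hy _) _ (hy _)

theorem isGen_comp_iff (h : H ⟶ G) {S : Set H.V}
    (hd : ∀ a ∈ S, ∀ b ∈ S, G.dist (vmap h a) (vmap h b) = H.dist a b) {k ℓ : ℕ}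
    {y : Fin (k + 1) → H.V} (hy : ∀ m, y m ∈ S) :
    G.IsGen k ℓ (vmap h ∘ y) ↔ H.IsGen k ℓ y := by
  constructor
  · refine fun hg => ⟨fun t ht => hg.1 t (congrArg (vmap h) ht), ?_⟩
    rw [← length_map_eq h hd hy, hg.2]
  · exact fun hg => hg.map h (by rw [length_map_eq h hd hy, hg.2])

end Generators

/-! ### Restriction of chains to a convex set of vertices -/

section Comap

/-- `h` maps `S` isometrically onto a convex set of vertices. -/
structure IsConvexOn (h : H ⟶ G) (S : Set H.V) : Prop where
  dist_map : ∀ a ∈ S, ∀ b ∈ S, G.dist (vmap h a) (vmap h b) = H.dist a b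
  mem_image : ∀ a ∈ vmap h '' S, ∀ b ∈ vmap h '' S, ∀ c, G.dist a c ≠ ⊤ → G.dist c b ≠ ⊤ →
    c ∈ vmap h '' S

open Classical in
/-- The map on chains which restricts a tuple along `h : H ⟶ G` if all its entries are in the image
of `S`, and annihilates it otherwise. -/
noncomputable def comap (h : H ⟶ G) (S : Set H.V) (k ℓ : ℕ) :
    (G.Gen k ℓ →₀ R) →ₗ[R] (H.Gen k ℓ →₀ R) :=
  Finsupp.linearCombination R fun x =>
    if hx : ∃ y : Fin (k + 1) → H.V, (∀ m, y m ∈ S) ∧ vmap h ∘ y = x.1 then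
      chain R H k ℓ hx.choose else 0

variable {h : H ⟶ G} {S : Set H.V}

theorem comap_chain_comp (hS : IsConvexOn h S) {k ℓ : ℕ} {y : Fin (k + 1) → H.V}
    (hy : ∀ m, y m ∈ S) : comap R h S k ℓ (chain R G k ℓ (vmap h ∘ y)) = chain R H k ℓ y := by
  by_cases hg : G.IsGen k ℓ (vmap h ∘ y)
  · have hx : ∃ z : Fin (k + 1) → H.V, (∀ m, z m ∈ S) ∧ vmap h ∘ z = vmap h ∘ y := ⟨y, hy, rfl⟩
    rw [chain_of_isGen R hg, comap, Finsupp.linearCombination_single, one_smul, dif_pos hx]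
    -- The chosen lift is `y` itself: `h` is isometric on `S`, so lifts with the same image are at
    -- distance zero.
    congr 1
    funext m
    apply eq_of_dist_eq_zero
    rw [← hS.dist_map _ (hx.choose_spec.1 m) _ (hy m)]
    have := congrFun hx.choose_spec.2 m
    simp only [Function.comp_apply] at this
    rw [this, dist_self]
  · rw [chain_of_not_isGen R hg, map_zero,
      chain_of_not_isGen R ((isGen_comp_iff h hS.dist_map hy).not.1 hg)]

theorem comap_chain_of_notMem {k ℓ : ℕ} {x : Fin (k + 1) → G.V} {m : Fin (k + 1)}
    (hm : x m ∉ vmap h '' S) : comap R h S k ℓ (chain R G k ℓ x) = 0 := by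
  by_cases hg : G.IsGen k ℓ x
  · rw [chain_of_isGen R hg, comap, Finsupp.linearCombination_single, one_smul, dif_neg]
    rintro ⟨y, hy, rfl⟩
    exact hm ⟨y m, hy m, rfl⟩
  · rw [chain_of_not_isGen R hg, map_zero]

theorem exists_comp_eq {k : ℕ} {x : Fin k → G.V} (hx : ∀ m, x m ∈ vmap h '' S) :
    ∃ y : Fin k → H.V, (∀ m, y m ∈ S) ∧ vmap h ∘ y = x := by
  choose y hy using hx
  exact ⟨y, fun m => (hy m).1, funext fun m => (hy m).2⟩

/-- A face of full length deletes an inner entry, which lies on a path between its two neighbours,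
so convexity applies. -/
theorem IsConvexOn.mem_image_of_removeNth (hS : IsConvexOn h S) {k ℓ : ℕ}
    {x : Fin (k + 2) → G.V} (hx : G.IsGen (k + 1) ℓ x) {m : Fin (k + 2)}
    (hm : G.IsGen k ℓ (m.removeNth x)) (hmem : ∀ t, m.removeNth x t ∈ vmap h '' S)
    (t : Fin (k + 2)) : x t ∈ vmap h '' S := by
  have hne : ∀ s, s ≠ m → x s ∈ vmap h '' S := fun s hs => by
    obtain ⟨r, rfl⟩ := Fin.exists_succAbove_eq hs
    exact hmem r
  by_cases ht : t = m
  swap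
  · exact hne t ht
  subst ht
  cases t using Fin.cases with
  | zero =>
    rw [removeNth_zero_eq_tail] at hm
    exact absurd hm.2 hx.length_tail_lt.ne
  | succ s =>
    cases s using Fin.lastCases with
    | last =>
      rw [Fin.succ_last, removeNth_last_eq_init] at hm
      exact absurd hm.2 hx.length_init_lt.ne
    | cast r =>
      refine hS.mem_image (x r.castSucc.castSucc) (hne _ ?_) (x r.succ.succ) (hne _ ?_) _
        (hx.dist_ne_top r.castSucc) ?_
      · exact (Fin.castSucc_lt_succ).ne
      · exact (Fin.succ_lt_succ_iff.2 Fin.castSucc_lt_succ).ne'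
      · have := hx.dist_ne_top r.succ
        rwa [← Fin.succ_castSucc] at this

theorem comap_comp_boundary (hS : IsConvexOn h S) (k ℓ : ℕ) :
    comap R h S k ℓ ∘ₗ boundary R G k ℓ = boundary R H k ℓ ∘ₗ comap R h S (k + 1) ℓ := by
  refine Finsupp.lhom_ext' fun x => LinearMap.ext_ring ?_
  simp only [LinearMap.comp_apply, Finsupp.lsingle_apply]
  rw [boundary_single, map_sum, ← chain_of_isGen R x.2]
  simp only [map_smul]
  by_cases hx : ∀ m, x.1 m ∈ vmap h '' S
  · obtain ⟨y, hy, hyx⟩ := exists_comp_eq hx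
    have hg : H.IsGen (k + 1) ℓ y :=
      (isGen_comp_iff h hS.dist_map hy).1 (by rw [hyx]; exact x.2)
    rw [← hyx, comap_chain_comp R hS hy, boundary_chain R (Or.inl hg)]
    exact Finset.sum_congr rfl fun m _ =>
      congrArg _ (comap_chain_comp R hS (y := m.removeNth y) fun t => hy _)
  · push Not at hx
    obtain ⟨t, ht⟩ := hx
    rw [comap_chain_of_notMem R ht, map_zero]
    refine Finset.sum_eq_zero fun m _ => ?_
    by_cases hm : G.IsGen k ℓ (m.removeNth x.1)
    · by_cases hmem : ∀ t, m.removeNth x.1 t ∈ vmap h '' S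
      · exact absurd (hS.mem_image_of_removeNth x.2 hm hmem t) ht
      · push Not at hmem
        obtain ⟨s, hs⟩ := hmem
        rw [comap_chain_of_notMem R hs, smul_zero]
    · rw [chain_of_not_isGen R hm, map_zero, smul_zero]

end Comap

/-! ### The endomorphism of the chains given by a projection -/

section Projection

variable {A X : DirGraph.{u}} {i : A ⟶ X} {p : X.V → A.V}

theorem IsInitialEmbedding.isConvexOn (hi : IsInitialEmbedding i) :
    IsConvexOn i Set.univ where
  dist_map a _ b _ := hi.dist_map a b
  mem_image a _ b hb c _ h := by
    rw [Set.image_univ] at hb ⊢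
    exact hi.mem_range h hb

theorem IsInitialEmbedding.forall_notMem (hi : IsInitialEmbedding i) {k ℓ : ℕ}
    {x : Fin (k + 1) → X.V} (hx : X.IsGen k ℓ x) (h0 : x 0 ∉ Set.range (vmap i))
    (t : Fin (k + 1)) : x t ∉ Set.range (vmap i) :=
  hx.forall_mem (S := (Set.range (vmap i))ᶜ) (fun _ _ h ha hb => ha (hi.mem_range h hb)) h0 t

/-- The left side is the distance from `i (p a)` to `b`, so this is a triangle inequality. It is the
hypothesis `hq` of the prism lemmas for `q = i ∘ p`. -/
theorem IsProjection.dist_add_dist_le (hp : IsProjection i p) (a b : X.V) :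
    X.dist (vmap i (p a)) (vmap i (p b)) + X.dist (vmap i (p b)) b ≤
      X.dist (vmap i (p a)) a + X.dist a b := by
  rw [← hp b (p a)]
  exact dist_triangle _ _ _

theorem IsProjection.vmap_eq (hp : IsProjection i p) {x : X.V} (hx : x ∈ Set.range (vmap i)) :
    vmap i (p x) = x := by
  obtain ⟨a, rfl⟩ := hx
  have := hp (vmap i a) a
  rw [dist_self] at this
  exact eq_of_dist_eq_zero (add_eq_zero.1 this.symm).2

theorem IsProjection.dist_add_length (hp : IsProjection i p) {k : ℕ} {x : Fin (k + 1) → X.V}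
    (h0 : x 0 ∈ Set.range (vmap i)) :
    X.dist (vmap i (p (x 0))) (x 0) + X.length x = X.length x := by
  rw [hp.vmap_eq h0, dist_self, zero_add]

/-- If a later entry lies in `A`, then so does `x₁`, since no path enters `A`. As `q` fixes `x₁`,
the prism on the tail is no longer than the tail, which is too short. -/
theorem prism_tail_eq_zero (hi : IsInitialEmbedding i) (hp : IsProjection i p) {k ℓ : ℕ}
    {x : Fin (k + 1) → X.V} (hx : X.IsGen k ℓ x)
    (h : ¬ ∀ m : Fin k, x m.succ ∉ Set.range (vmap i)) :
    prism R (fun a => vmap i (p a)) k ℓ (Fin.tail x) = 0 := by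
  cases k with
  | zero => rfl
  | succ k =>
    have h1 : x 1 ∈ Set.range (vmap i) := by
      by_contra h1
      refine h fun m => ?_
      induction m using Fin.induction with
      | zero => exact h1
      | succ m ih => exact fun hm => ih (hi.mem_range (hx.dist_ne_top m.succ) hm)
    refine prism_of_lt R hp.dist_add_dist_le ?_
    rw [hp.dist_add_length (x := Fin.tail x) h1]
    exact hx.length_tail_lt

open Classical in
/-- A tuple starting outside `A` is fixed; a tuple `(x₀, x₁, …)` starting in `A` is sent to the
sum of its projection to `A` and the prism on `(x₁, …)`. -/
noncomputable def projEnd (i : A ⟶ X) (p : X.V → A.V) (k ℓ : ℕ) :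
    (X.Gen k ℓ →₀ R) →ₗ[R] (X.Gen k ℓ →₀ R) :=
  Finsupp.linearCombination R fun x =>
    if x.1 0 ∈ Set.range (vmap i) then
      chain R X k ℓ (fun m => vmap i (p (x.1 m))) +
        prism R (fun a => vmap i (p a)) k ℓ (Fin.tail x.1)
    else chain R X k ℓ x.1

open Classical in
/-- The homotopy: the prism on the tuples starting in `A`. -/
noncomputable def projHomotopy (i : A ⟶ X) (p : X.V → A.V) (k ℓ : ℕ) :
    (X.Gen k ℓ →₀ R) →ₗ[R] (X.Gen (k + 1) ℓ →₀ R) :=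
  Finsupp.linearCombination R fun x =>
    if x.1 0 ∈ Set.range (vmap i) then prism R (fun a => vmap i (p a)) (k + 1) ℓ x.1 else 0

theorem projEnd_chain_of_mem {k ℓ : ℕ} {x : Fin (k + 1) → X.V} (hx : X.IsGen k ℓ x)
    (h0 : x 0 ∈ Set.range (vmap i)) :
    projEnd R i p k ℓ (chain R X k ℓ x) = chain R X k ℓ (fun m => vmap i (p (x m))) +
        prism R (fun a => vmap i (p a)) k ℓ (Fin.tail x) := by
  rw [chain_of_isGen R hx, projEnd, Finsupp.linearCombination_single, one_smul, if_pos h0]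

theorem projEnd_chain_of_notMem {k ℓ : ℕ} {x : Fin (k + 1) → X.V} (hx : X.IsGen k ℓ x)
    (h0 : x 0 ∉ Set.range (vmap i)) :
    projEnd R i p k ℓ (chain R X k ℓ x) = chain R X k ℓ x := by
  conv_lhs => rw [chain_of_isGen R hx]
  rw [projEnd, Finsupp.linearCombination_single, one_smul, if_neg h0]

theorem projHomotopy_chain_of_mem {k ℓ : ℕ} {x : Fin (k + 1) → X.V} (hx : X.IsGen k ℓ x)
    (h0 : x 0 ∈ Set.range (vmap i)) :
    projHomotopy R i p k ℓ (chain R X k ℓ x) =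
      prism R (fun a => vmap i (p a)) (k + 1) ℓ x := by
  rw [chain_of_isGen R hx, projHomotopy, Finsupp.linearCombination_single, one_smul, if_pos h0]

theorem projHomotopy_chain_of_notMem {k ℓ : ℕ} {x : Fin (k + 1) → X.V}
    (h0 : x 0 ∉ Set.range (vmap i)) :
    projHomotopy R i p k ℓ (chain R X k ℓ x) = 0 := by
  by_cases hx : X.IsGen k ℓ x
  · rw [chain_of_isGen R hx, projHomotopy, Finsupp.linearCombination_single, one_smul, if_neg h0]
  · rw [chain_of_not_isGen R hx, map_zero]

theorem boundary_comp_projHomotopy_zero (hp : IsProjection i p) (ℓ : ℕ) :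
    LinearMap.id = projEnd R i p 0 ℓ + boundary R X 0 ℓ ∘ₗ projHomotopy R i p 0 ℓ := by
  refine Finsupp.lhom_ext' fun x => LinearMap.ext_ring ?_
  simp only [LinearMap.comp_apply, Finsupp.lsingle_apply, LinearMap.add_apply,
    LinearMap.id_apply]
  rw [← chain_of_isGen R x.2]
  by_cases h0 : x.1 0 ∈ Set.range (vmap i)
  · rw [projEnd_chain_of_mem R x.2 h0, projHomotopy_chain_of_mem R x.2 h0,
      boundary_prism R hp.dist_add_dist_le]
    · simp only [prism_zero, smul_zero, Finset.sum_const_zero, Function.comp_def]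
      abel
    · exact ((hp.dist_add_length h0).trans x.2.2).le
  · rw [projEnd_chain_of_notMem R x.2 h0, projHomotopy_chain_of_notMem R h0, map_zero, add_zero]

/-- In the prism formula, deletion of `x₀` contributes the prism on the tail, which has no
counterpart in `projHomotopy ∘ boundary`; it is the second term of `projEnd`. All other faces keep
`x₀`, hence keep the case distinction. -/
theorem boundary_comp_projHomotopy_succ (hp : IsProjection i p)
    (k ℓ : ℕ) :
    LinearMap.id = projEnd R i p (k + 1) ℓ +
      (boundary R X (k + 1) ℓ ∘ₗ projHomotopy R i p (k + 1) ℓ +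
        projHomotopy R i p k ℓ ∘ₗ boundary R X k ℓ) := by
  refine Finsupp.lhom_ext' fun x => LinearMap.ext_ring ?_
  simp only [LinearMap.comp_apply, Finsupp.lsingle_apply, LinearMap.add_apply,
    LinearMap.id_apply]
  rw [boundary_single, map_sum, ← chain_of_isGen R x.2, Fin.sum_univ_succ]
  have hz : chain R X k ℓ ((0 : Fin (k + 2)).removeNth x.1) = 0 :=
    chain_of_lt R (by rw [removeNth_zero_eq_tail]; exact x.2.length_tail_lt)
  simp only [map_smul, hz, map_zero, smul_zero, zero_add]
  by_cases h0 : x.1 0 ∈ Set.range (vmap i)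
  · have h0' : ∀ m : Fin (k + 1), m.succ.removeNth x.1 0 ∈ Set.range (vmap i) := fun m => by
      rwa [removeNth_succ_zero]
    have hface : ∀ m : Fin (k + 1), projHomotopy R i p k ℓ (chain R X k ℓ (m.succ.removeNth x.1)) =
        prism R (fun a => vmap i (p a)) (k + 1) ℓ (m.succ.removeNth x.1) := fun m => by
      by_cases hg : X.IsGen k ℓ (m.succ.removeNth x.1)
      · exact projHomotopy_chain_of_mem R hg (h0' m)
      -- A face omitted by the differential is shorter than `ℓ` and starts in `A`, so its prism is
      -- too short as well.
      · rw [chain_of_not_isGen R hg, map_zero, prism_of_lt R hp.dist_add_dist_le]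
        rw [hp.dist_add_length (h0' m)]
        exact (x.2.removeNth_or _).resolve_left hg
    simp only [hface]
    rw [projEnd_chain_of_mem R x.2 h0, projHomotopy_chain_of_mem R x.2 h0,
      boundary_prism R hp.dist_add_dist_le ((hp.dist_add_length h0).trans x.2.2).le,
      Fin.sum_univ_succ, removeNth_zero_eq_tail]
    simp only [Fin.val_zero, pow_zero, one_smul, Function.comp_def]
    abel
  · rw [projEnd_chain_of_notMem R x.2 h0, projHomotopy_chain_of_notMem R h0, map_zero, zero_add]
    rw [Finset.sum_eq_zero, add_zero]
    intro m _
    rw [projHomotopy_chain_of_notMem, smul_zero]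
    rwa [removeNth_succ_zero]

theorem chainMap_comap_of_mem (hi : IsInitialEmbedding i) {k ℓ : ℕ} {x : Fin (k + 1) → X.V}
    (hx : X.IsGen k ℓ x) (h : ∀ m, x m ∈ Set.range (vmap i)) :
    chainMap R i k ℓ (comap R i Set.univ k ℓ (chain R X k ℓ x)) = chain R X k ℓ x := by
  obtain ⟨y, hy, rfl⟩ := exists_comp_eq (S := Set.univ) (fun m => by
    rw [Set.image_univ]; exact h m)
  have hd := hi.isConvexOn.dist_map
  rw [comap_chain_comp R hi.isConvexOn hy,
    chainMap_chain R i (Or.inl ((isGen_comp_iff i hd hy).1 hx))]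

theorem comap_univ_chain_of_notMem {k ℓ : ℕ} {x : Fin (k + 1) → X.V} {m : Fin (k + 1)}
    (h : x m ∉ Set.range (vmap i)) : comap R i Set.univ k ℓ (chain R X k ℓ x) = 0 :=
  comap_chain_of_notMem R (m := m) (by rwa [Set.image_univ])

/-- If the last entry lies in `A`, all entries do and the projection fixes them. Otherwise the
restriction is zero, and the projected tuple is shorter by at least the positive distance from the
last entry's projection to the last entry. -/
theorem chainMap_comap_chain (hi : IsInitialEmbedding i) (hp : IsProjection i p) {k ℓ : ℕ}
    {x : Fin (k + 1) → X.V} (hx : X.IsGen k ℓ x) (h0 : x 0 ∈ Set.range (vmap i)) :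
    chainMap R i k ℓ (comap R i Set.univ k ℓ (chain R X k ℓ x)) =
      chain R X k ℓ (fun m => vmap i (p (x m))) := by
  by_cases hl : x (Fin.last k) ∈ Set.range (vmap i)
  · have hall : ∀ m, x m ∈ Set.range (vmap i) := by
      intro m
      induction m using Fin.reverseInduction with
      | last => exact hl
      | cast m ih => exact hi.mem_range (hx.dist_ne_top m) ih
    rw [chainMap_comap_of_mem R hi hx hall]
    exact congrArg _ (funext fun m => (hp.vmap_eq (hall m)).symm)
  · rw [comap_univ_chain_of_notMem R hl, map_zero, chain_of_lt]
    have hle := (length_comp_add_dist_le hp.dist_add_dist_le x).trans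
      ((hp.dist_add_length h0).trans hx.2).le
    refine lt_of_lt_of_le ?_ hle
    rw [add_comm (X.length _)]
    refine ENat.lt_add_left (fun htop => ?_) (pos_iff_ne_zero.2 fun h => ?_)
    · have hle' := le_self_add.trans hle
      rw [Function.comp_def, htop] at hle'
      simp at hle'
    · exact hl ⟨_, eq_of_dist_eq_zero h⟩

end Projection

/-! ### The chain map from the pushout to `X` -/

section Pushout

variable {A X Y P : DirGraph.{u}} {i : A ⟶ X} {f : A ⟶ Y} {g : X ⟶ P} {j : Y ⟶ P}

/-- The image is the complement of `Y`, and a path that starts there never returns to `Y`. -/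
theorem IsMetricPushout.isConvexOn (h : IsMetricPushout i f g j) :
    IsConvexOn g (Set.range (vmap i))ᶜ where
  dist_map := h.dist_map
  mem_image := by
    rintro _ ⟨x, hx, rfl⟩ b - c hc -
    have : c ∉ Set.range (vmap j) := fun hcj =>
      h.notMem_range x hx (h.isInitialEmbedding.mem_range hc hcj)
    obtain ⟨x', hx', rfl⟩ := h.exists_eq c this
    exact ⟨x', hx', rfl⟩

theorem IsMetricPushout.injOn (h : IsMetricPushout i f g j) :
    Set.InjOn (vmap g) (Set.range (vmap i))ᶜ := fun x hx x' hx' he =>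
  eq_of_dist_eq_zero (by rw [← h.dist_map x hx x' hx', he, dist_self])

theorem IsMetricPushout.notMem_image (h : IsMetricPushout i f g j) {q : P.V}
    (hq : q ∈ Set.range (vmap j)) : q ∉ vmap g '' (Set.range (vmap i))ᶜ := by
  rintro ⟨x, hx, rfl⟩
  exact h.notMem_range x hx hq

theorem IsMetricPushout.mem_image (h : IsMetricPushout i f g j) {q : P.V}
    (hq : q ∉ Set.range (vmap j)) : q ∈ vmap g '' (Set.range (vmap i))ᶜ := by
  obtain ⟨x, hx, rfl⟩ := h.exists_eq q hq
  exact ⟨x, hx, rfl⟩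

theorem IsMetricPushout.vmap_mem_range (h : IsMetricPushout i f g j) {x : X.V}
    (hx : x ∈ Set.range (vmap i)) : vmap g x ∈ Set.range (vmap j) := by
  obtain ⟨a, rfl⟩ := hx
  exact ⟨_, (h.comm a).symm⟩

/-- Vertices of `Y` project to themselves, and `g x` projects to `f (p x)` by the distance formula.
Injectivity of `g` outside `A` makes this independent of `x`. -/
theorem IsMetricPushout.exists_isProjection (h : IsMetricPushout i f g j)
    (hi : IsInitialEmbedding i) {p : X.V → A.V} (hp : IsProjection i p) :
    ∃ p' : P.V → Y.V, IsProjection j p' ∧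
      ∀ x ∉ Set.range (vmap i), p' (vmap g x) = vmap f (p x) := by
  have key : ∀ q : P.V, ∃ y : Y.V, (∀ y', P.dist (vmap j y') q =
      P.dist (vmap j y') (vmap j y) + P.dist (vmap j y) q) ∧
      ∀ x ∉ Set.range (vmap i), vmap g x = q → y = vmap f (p x) := by
    intro q
    by_cases hq : q ∈ Set.range (vmap j)
    · obtain ⟨y, rfl⟩ := hq
      refine ⟨y, fun y' => by rw [dist_self, add_zero], fun x hx hxy => ?_⟩
      exact absurd ⟨y, hxy.symm⟩ (h.notMem_range x hx)
    · obtain ⟨x, hx, rfl⟩ := h.exists_eq q hq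
      refine ⟨vmap f (p x), fun y' => ?_, fun x' hx' he => ?_⟩
      · rw [h.dist_eq_of_isProjection hi hp _ hx, h.dist_eq_of_isProjection hi hp _ hx, dist_self,
          zero_add, h.isInitialEmbedding.dist_map]
      · rw [h.injOn hx' hx he]
  choose p' hp' using key
  exact ⟨p', fun q => (hp' q).1, fun x hx => (hp' _).2 x hx rfl⟩

theorem IsMetricPushout.exists_leftInverse (h : IsMetricPushout i f g j) [Nonempty X.V] :
    ∃ r : P.V → X.V, ∀ x ∉ Set.range (vmap i), r (vmap g x) = x := by
  classical
  refine ⟨Function.invFunOn (vmap g) (Set.range (vmap i))ᶜ, fun x hx => ?_⟩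
  exact h.injOn.leftInvOn_invFunOn hx

open Classical in
/-- A tuple `(y, x₁, …)` with only the first entry in `Y` is sent to the prism on `(x₁, …)`, and the
other tuples to zero. -/
noncomputable def prismMap (i : A ⟶ X) (j : Y ⟶ P) (p : X.V → A.V) (r : P.V → X.V) (k ℓ : ℕ) :
    (P.Gen k ℓ →₀ R) →ₗ[R] (X.Gen k ℓ →₀ R) :=
  Finsupp.linearCombination R fun w =>
    if w.1 0 ∈ Set.range (vmap j) ∧ ∀ m : Fin k, w.1 m.succ ∉ Set.range (vmap j) then
      prism R (fun a => vmap i (p a)) k ℓ (r ∘ Fin.tail w.1) else 0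

variable {p : X.V → A.V} {r : P.V → X.V}

theorem prismMap_chain_of_not {k ℓ : ℕ} {w : Fin (k + 1) → P.V}
    (hw : ¬ (w 0 ∈ Set.range (vmap j) ∧ ∀ m : Fin k, w m.succ ∉ Set.range (vmap j))) :
    prismMap R i j p r k ℓ (chain R P k ℓ w) = 0 := by
  by_cases hg : P.IsGen k ℓ w
  · rw [chain_of_isGen R hg, prismMap, Finsupp.linearCombination_single, one_smul, if_neg hw]
  · rw [chain_of_not_isGen R hg, map_zero]

theorem IsMetricPushout.vmap_leftInverse
    (h : IsMetricPushout i f g j) (hr : ∀ x ∉ Set.range (vmap i), r (vmap g x) = x)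
    {q : P.V} (hq : q ∉ Set.range (vmap j)) :
    vmap g (r q) = q ∧ r q ∉ Set.range (vmap i) := by
  obtain ⟨x, hx, rfl⟩ := h.exists_eq q hq
  rw [hr x hx]
  exact ⟨rfl, hx⟩

theorem IsMetricPushout.length_leftInverse_comp
    (h : IsMetricPushout i f g j) (hr : ∀ x ∉ Set.range (vmap i), r (vmap g x) = x)
    {k : ℕ} {w : Fin (k + 1) → P.V}
    (hw : ∀ m, w m ∉ Set.range (vmap j)) : X.length (r ∘ w) = P.length w := by
  rw [← length_map_eq g h.isConvexOn.dist_map (y := r ∘ w)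
    fun m => (h.vmap_leftInverse hr (hw m)).2]
  exact congrArg _ (funext fun m => (h.vmap_leftInverse hr (hw m)).1)

/-- The first step of `w` passes through the projection of `w₁`, so it is at least as long as the
step from that projection to `w₁`. This bounds the prism on the tail. -/
theorem IsMetricPushout.dist_add_length_le
    (h : IsMetricPushout i f g j) (hr : ∀ x ∉ Set.range (vmap i), r (vmap g x) = x)
    (hi : IsInitialEmbedding i) (hp : IsProjection i p)
    {k : ℕ} {w : Fin (k + 2) → P.V} (h0 : w 0 ∈ Set.range (vmap j))
    (hw : ∀ m : Fin (k + 1), w m.succ ∉ Set.range (vmap j)) :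
    X.dist (vmap i (p ((r ∘ Fin.tail w) 0))) ((r ∘ Fin.tail w) 0) +
      X.length (r ∘ Fin.tail w) ≤ P.length w := by
  rw [h.length_leftInverse_comp hr (w := Fin.tail w) hw, length_succ]
  refine add_le_add_left ?_ _
  obtain ⟨y, hy⟩ := h0
  obtain ⟨x, hx, hxw⟩ := h.exists_eq _ (hw 0)
  have h1 : (r ∘ Fin.tail w) 0 = x := by
    rw [← hr x hx, hxw]
    rfl
  have h2 : w 1 = vmap g x := hxw.symm
  rw [h1, h2, ← hy, h.dist_eq_of_isProjection hi hp y hx]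
  exact le_add_self

theorem IsMetricPushout.prismMap_chain
    (h : IsMetricPushout i f g j) (hr : ∀ x ∉ Set.range (vmap i), r (vmap g x) = x)
    (hi : IsInitialEmbedding i) (hp : IsProjection i p)
    {k ℓ : ℕ} {w : Fin (k + 1) → P.V} (hg : P.IsGen k ℓ w ∨ P.length w < ℓ)
    (h0 : w 0 ∈ Set.range (vmap j)) (hw : ∀ m : Fin k, w m.succ ∉ Set.range (vmap j)) :
    prismMap R i j p r k ℓ (chain R P k ℓ w) =
      prism R (fun a => vmap i (p a)) k ℓ (r ∘ Fin.tail w) := by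
  by_cases hg' : P.IsGen k ℓ w
  · rw [chain_of_isGen R hg', prismMap, Finsupp.linearCombination_single, one_smul,
      if_pos ⟨h0, hw⟩]
  · rw [chain_of_not_isGen R hg', map_zero]
    cases k with
    | zero => rfl
    | succ k =>
      exact (prism_of_lt R hp.dist_add_dist_le
        ((h.dist_add_length_le hr hi hp h0 hw).trans_lt (hg.resolve_left hg'))).symm

/-- For `w = (y, w₁, …)` with `w₁, …` outside `Y`, the end terms of the prism formula on the tail
are too short, and the sign in front of its sum matches the index shift between faces of the tail
and of `w`. For other tuples no face may contribute. -/
theorem IsMetricPushout.prismMap_comp_boundary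
    (h : IsMetricPushout i f g j) (hr : ∀ x ∉ Set.range (vmap i), r (vmap g x) = x)
    (hi : IsInitialEmbedding i)
    (hp : IsProjection i p) (k ℓ : ℕ) :
    prismMap R i j p r k ℓ ∘ₗ boundary R P k ℓ =
      boundary R X k ℓ ∘ₗ prismMap R i j p r (k + 1) ℓ := by
  refine Finsupp.lhom_ext' fun x => LinearMap.ext_ring ?_
  simp only [LinearMap.comp_apply, Finsupp.lsingle_apply]
  rw [boundary_single, map_sum, ← chain_of_isGen R x.2, Fin.sum_univ_succ]
  obtain ⟨w, hg⟩ := x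
  dsimp only
  have hz : chain R P k ℓ ((0 : Fin (k + 2)).removeNth w) = 0 :=
    chain_of_lt R (by rw [removeNth_zero_eq_tail]; exact hg.length_tail_lt)
  simp only [map_smul, hz, map_zero, smul_zero, zero_add]
  by_cases hw : w 0 ∈ Set.range (vmap j) ∧ ∀ m : Fin (k + 1), w m.succ ∉ Set.range (vmap j)
  · obtain ⟨h0, hw⟩ := hw
    have hle := (h.dist_add_length_le hr hi hp h0 hw).trans hg.2.le
    rw [h.prismMap_chain R hr hi hp (Or.inl hg) h0 hw,
      boundary_prism R hp.dist_add_dist_le hle, chain_of_lt, chain_of_lt, sub_zero, zero_sub,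
      ← Finset.sum_neg_distrib]
    · refine Finset.sum_congr rfl fun m _ => ?_
      rw [h.prismMap_chain R hr hi hp (hg.removeNth_or m.succ) (by rwa [removeNth_succ_zero])
        fun t => by rw [Fin.removeNth, Fin.succ_succAbove_succ]; exact hw _,
        tail_removeNth_succ, Fin.val_succ, pow_succ, mul_neg_one, neg_smul]
      rfl
    -- The last entry lies outside `A`, so projecting it loses a positive distance.
    · refine lt_of_lt_of_le ?_
        ((length_comp_add_dist_le hp.dist_add_dist_le (r ∘ Fin.tail w)).trans hle)
      rw [add_comm (X.length _)]
      refine ENat.lt_add_left (fun htop => ?_) (pos_iff_ne_zero.2 fun h0 => ?_)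
      · have hle' := le_self_add.trans
          ((length_comp_add_dist_le hp.dist_add_dist_le (r ∘ Fin.tail w)).trans hle)
        rw [htop] at hle'
        simp at hle'
      · exact (h.vmap_leftInverse hr (hw (Fin.last k))).2 ⟨_, eq_of_dist_eq_zero h0⟩
    · rw [h.length_leftInverse_comp hr (w := Fin.tail w) hw]
      exact hg.length_tail_lt
  · rw [prismMap_chain_of_not R hw, map_zero]
    refine Finset.sum_eq_zero fun m _ => ?_
    by_cases hc : m.succ.removeNth w 0 ∈ Set.range (vmap j) ∧
        ∀ t : Fin k, m.succ.removeNth w t.succ ∉ Set.range (vmap j)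
    swap
    · rw [prismMap_chain_of_not R hc, smul_zero]
    rw [h.prismMap_chain R hr hi hp (hg.removeNth_or m.succ) hc.1 hc.2, tail_removeNth_succ]
    cases k with
    | zero => rw [prism_zero, smul_zero]
    | succ k =>
      rw [removeNth_succ_zero] at hc
      have hout : ∀ s : Fin (k + 2), s ≠ m → w s.succ ∉ Set.range (vmap j) := fun s hs => by
        obtain ⟨t, rfl⟩ := Fin.exists_succAbove_eq hs
        have := hc.2 t
        rwa [Fin.removeNth, Fin.succ_succAbove_succ] at this
      have hm : w m.succ ∈ Set.range (vmap j) := by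
        by_contra hm
        refine hw ⟨hc.1, fun s => ?_⟩
        by_cases hs : s = m
        · rwa [hs]
        · exact hout s hs
      -- The deleted entry is the only one after `w₀` lying in `Y`. It must be `w₁`, since otherwise
      -- its predecessor would lie outside `Y` and have a path into `Y`. For `w₁`, the prism on
      -- `(w₂, …)` is bounded by the length of `(w₁, w₂, …)`, which is less than `ℓ`.
      cases m using Fin.cases with
      | succ m =>
        have := hg.dist_ne_top m.succ
        rw [← Fin.succ_castSucc] at this
        exact absurd (h.isInitialEmbedding.mem_range this hm)
          (hout _ (Fin.castSucc_lt_succ).ne)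
      | zero =>
        rw [removeNth_zero_eq_tail]
        have hlt := (h.dist_add_length_le hr hi hp (w := Fin.tail w) hm
          fun s => hout s.succ (Fin.succ_ne_zero s)).trans_lt hg.length_tail_lt
        have := prism_of_lt R hp.dist_add_dist_le hlt
        rw [this, smul_zero]

/-- For tuples starting in `A`, the projected tuple gives the retraction and the prism on the tail
gives `prismMap`. For tuples starting outside `A`, every entry is outside `A` and only restriction
along `g` survives. -/
theorem IsMetricPushout.projEnd_eq_left
    (h : IsMetricPushout i f g j) (hr : ∀ x ∉ Set.range (vmap i), r (vmap g x) = x)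
    (hi : IsInitialEmbedding i) (hp : IsProjection i p)
    (k ℓ : ℕ) :
    projEnd R i p k ℓ = chainMap R i k ℓ ∘ₗ comap R i Set.univ k ℓ +
      (comap R g (Set.range (vmap i))ᶜ k ℓ + prismMap R i j p r k ℓ) ∘ₗ chainMap R g k ℓ := by
  refine Finsupp.lhom_ext' fun x => LinearMap.ext_ring ?_
  simp only [LinearMap.comp_apply, Finsupp.lsingle_apply, LinearMap.add_apply]
  rw [chainMap_single, ← chain_of_isGen R x.2]
  obtain ⟨x, hx⟩ := x
  dsimp only
  by_cases h0 : x 0 ∈ Set.range (vmap i)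
  · rw [projEnd_chain_of_mem R hx h0, chainMap_comap_chain R hi hp hx h0,
      comap_chain_of_notMem R (m := 0) (h.notMem_image (h.vmap_mem_range h0)), zero_add]
    congr 1
    by_cases ht : ∀ m : Fin k, x m.succ ∉ Set.range (vmap i)
    · rw [h.prismMap_chain R hr hi hp (hx.map_or g) (h.vmap_mem_range h0)
        fun m => h.notMem_range _ (ht m)]
      exact congrArg _ (funext fun m => (hr _ (ht m)).symm)
    · rw [prism_tail_eq_zero R hi hp hx ht, prismMap_chain_of_not]
      push Not at ht
      obtain ⟨m, hm⟩ := ht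
      exact fun hc => hc.2 m (h.vmap_mem_range hm)
  · have hall := hi.forall_notMem hx h0
    rw [projEnd_chain_of_notMem R hx h0, comap_univ_chain_of_notMem R h0, map_zero, zero_add,
      comap_chain_comp R h.isConvexOn hall,
      prismMap_chain_of_not R fun hc => h.notMem_range _ h0 hc.1, add_zero]

theorem IsMetricPushout.projEnd_eq_right
    (h : IsMetricPushout i f g j) (hr : ∀ x ∉ Set.range (vmap i), r (vmap g x) = x)
    (hi : IsInitialEmbedding i) (hp : IsProjection i p)
    {p' : P.V → Y.V} (hp' : IsProjection j p')
    (hpp : ∀ x ∉ Set.range (vmap i), p' (vmap g x) = vmap f (p x)) (k ℓ : ℕ) :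
    projEnd R j p' k ℓ = chainMap R j k ℓ ∘ₗ comap R j Set.univ k ℓ +
      chainMap R g k ℓ ∘ₗ (comap R g (Set.range (vmap i))ᶜ k ℓ + prismMap R i j p r k ℓ) := by
  refine Finsupp.lhom_ext' fun x => LinearMap.ext_ring ?_
  simp only [LinearMap.comp_apply, Finsupp.lsingle_apply, LinearMap.add_apply]
  rw [← chain_of_isGen R x.2]
  obtain ⟨w, hw⟩ := x
  dsimp only
  have hj := h.isInitialEmbedding
  by_cases h0 : w 0 ∈ Set.range (vmap j)
  · rw [projEnd_chain_of_mem R hw h0, chainMap_comap_chain R hj hp' hw h0,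
      comap_chain_of_notMem R (m := 0) (h.notMem_image h0), zero_add]
    congr 1
    by_cases ht : ∀ m : Fin k, w m.succ ∉ Set.range (vmap j)
    · rw [h.prismMap_chain R hr hi hp (Or.inl hw) h0 ht, prism, prism, map_sum]
      refine Finset.sum_congr rfl fun t _ => ?_
      rw [map_smul]
      cases k with
      | zero => exact t.elim0
      | succ k =>
        -- On entries outside `A` the map `g` intertwines the two projections, so it carries prism
        -- tuples to prism tuples, including degenerate ones.
        rw [chainMap_chain_of_le R g ((length_prismTuple_le hp.dist_add_dist_le t _).trans
          ((h.dist_add_length_le hr hi hp h0 ht).trans hw.2.le)),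
          comp_prismTuple (q' := fun a => vmap j (p' a))]
        · congr 2
          exact congrArg _ (funext fun m => (h.vmap_leftInverse hr (ht m)).1.symm)
        · intro m
          have := (h.vmap_leftInverse hr (ht m)).2
          rw [h.comm]
          exact congrArg (vmap j) (hpp _ this).symm
    · rw [prism_tail_eq_zero R hj hp' hw ht, prismMap_chain_of_not, map_zero]
      exact fun hc => ht hc.2
  · have hall := hj.forall_notMem hw h0
    obtain ⟨z, hz, rfl⟩ := exists_comp_eq fun m => h.mem_image (hall m)
    rw [projEnd_chain_of_notMem R hw h0, comap_univ_chain_of_notMem R h0, map_zero, zero_add,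
      comap_chain_comp R h.isConvexOn hz, prismMap_chain_of_not R fun hc => h0 hc.1, add_zero,
      chainMap_chain R g (Or.inl ((isGen_comp_iff g h.isConvexOn.dist_map hz).1 hw))]

/-! ### Chain-level identities for the retractions and the section -/

theorem prismMap_comp_chainMap (k ℓ : ℕ) :
    prismMap R i j p r k ℓ ∘ₗ chainMap R j k ℓ = 0 := by
  refine Finsupp.lhom_ext' fun x => LinearMap.ext_ring ?_
  simp only [LinearMap.comp_apply, Finsupp.lsingle_apply, LinearMap.zero_apply]
  rw [chainMap_single]
  cases k with
  | succ k => exact prismMap_chain_of_not R fun hc => hc.2 0 ⟨_, rfl⟩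
  | zero =>
    by_cases hg : P.IsGen 0 ℓ (vmap j ∘ x.1)
    · rw [chain_of_isGen R hg, prismMap, Finsupp.linearCombination_single, one_smul, prism_zero,
        ite_self]
    · rw [chain_of_not_isGen R hg, map_zero]

theorem IsMetricPushout.comap_comp_chainMap (h : IsMetricPushout i f g j) (k ℓ : ℕ) :
    comap R g (Set.range (vmap i))ᶜ k ℓ ∘ₗ chainMap R j k ℓ = 0 := by
  refine Finsupp.lhom_ext' fun x => LinearMap.ext_ring ?_
  simp only [LinearMap.comp_apply, Finsupp.lsingle_apply, LinearMap.zero_apply]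
  rw [chainMap_single, comap_chain_of_notMem R (m := 0) (h.notMem_image ⟨_, rfl⟩)]

theorem IsInitialEmbedding.comap_comp_chainMap (hi : IsInitialEmbedding i) (k ℓ : ℕ) :
    comap R i Set.univ k ℓ ∘ₗ chainMap R i k ℓ = LinearMap.id := by
  refine Finsupp.lhom_ext' fun x => LinearMap.ext_ring ?_
  simp only [LinearMap.comp_apply, Finsupp.lsingle_apply, LinearMap.id_apply]
  rw [chainMap_single, comap_chain_comp R hi.isConvexOn fun _ => Set.mem_univ _,
    chain_of_isGen R x.2]

/-- A vertex of `X` lies in `A` exactly when its image lies in `Y`, so both sides kill the same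
tuples. -/
theorem IsMetricPushout.chainMap_comp_comap (h : IsMetricPushout i f g j)
    (hi : IsInitialEmbedding i) (k ℓ : ℕ) :
    chainMap R f k ℓ ∘ₗ comap R i Set.univ k ℓ =
      comap R j Set.univ k ℓ ∘ₗ chainMap R g k ℓ := by
  refine Finsupp.lhom_ext' fun x => LinearMap.ext_ring ?_
  simp only [LinearMap.comp_apply, Finsupp.lsingle_apply]
  rw [chainMap_single, ← chain_of_isGen R x.2]
  obtain ⟨x, hx⟩ := x
  dsimp only
  by_cases hall : ∀ m, x m ∈ Set.range (vmap i)
  · obtain ⟨y, hy, rfl⟩ := exists_comp_eq (S := Set.univ) (fun m => by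
      rw [Set.image_univ]; exact hall m)
    have hc : vmap g ∘ vmap i ∘ y = vmap j ∘ vmap f ∘ y := funext fun m => h.comm _
    rw [comap_chain_comp R hi.isConvexOn hy, hc,
      comap_chain_comp R h.isInitialEmbedding.isConvexOn fun _ => Set.mem_univ _,
      chainMap_chain R f (Or.inl ((isGen_comp_iff i hi.isConvexOn.dist_map hy).1 hx))]
  · push Not at hall
    obtain ⟨m, hm⟩ := hall
    rw [comap_univ_chain_of_notMem R hm, map_zero,
      comap_univ_chain_of_notMem R (m := m) (h.notMem_range _ hm)]

theorem IsMetricPushout.id_eq_left_of_isEmpty [IsEmpty A.V] (h : IsMetricPushout i f g j)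
    (k ℓ : ℕ) :
    LinearMap.id = chainMap R i k ℓ ∘ₗ comap R i Set.univ k ℓ +
      comap R g (Set.range (vmap i))ᶜ k ℓ ∘ₗ chainMap R g k ℓ := by
  refine Finsupp.lhom_ext' fun x => LinearMap.ext_ring ?_
  simp only [LinearMap.comp_apply, Finsupp.lsingle_apply, LinearMap.add_apply,
    LinearMap.id_apply]
  have hall : ∀ m, x.1 m ∉ Set.range (vmap i) := fun m ⟨a, _⟩ => isEmptyElim a
  rw [chainMap_single, ← chain_of_isGen R x.2, comap_univ_chain_of_notMem R (hall 0), map_zero,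
    zero_add, comap_chain_comp R h.isConvexOn hall]

/-- With `A` empty there are no paths between `Y` and the image of `X`, so each generator lies
wholly on one side and no homotopy is needed. -/
theorem IsMetricPushout.id_eq_right_of_isEmpty [IsEmpty A.V] (h : IsMetricPushout i f g j)
    (k ℓ : ℕ) :
    LinearMap.id = chainMap R j k ℓ ∘ₗ comap R j Set.univ k ℓ +
      chainMap R g k ℓ ∘ₗ comap R g (Set.range (vmap i))ᶜ k ℓ := by
  refine Finsupp.lhom_ext' fun x => LinearMap.ext_ring ?_
  simp only [LinearMap.comp_apply, Finsupp.lsingle_apply, LinearMap.add_apply,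
    LinearMap.id_apply]
  rw [← chain_of_isGen R x.2]
  obtain ⟨w, hw⟩ := x
  dsimp only
  have hj := h.isInitialEmbedding
  by_cases h0 : w 0 ∈ Set.range (vmap j)
  · have hall : ∀ m, w m ∈ Set.range (vmap j) := by
      refine hw.forall_mem (fun a b hab ha => ?_) h0
      by_contra hb
      obtain ⟨y, rfl⟩ := ha
      obtain ⟨x, hx, rfl⟩ := h.exists_eq b hb
      exact hab (by rw [h.dist_eq y x hx, iInf_of_empty])
    rw [chainMap_comap_of_mem R hj hw hall,
      comap_chain_of_notMem R (m := 0) (h.notMem_image h0), map_zero, add_zero]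
  · obtain ⟨z, hz, rfl⟩ := exists_comp_eq fun m => h.mem_image (hj.forall_notMem hw h0 m)
    rw [comap_univ_chain_of_notMem R h0, map_zero, zero_add, comap_chain_comp R h.isConvexOn hz,
      chainMap_chain R g (Or.inl ((isGen_comp_iff g h.isConvexOn.dist_map hz).1 hw))]

end Pushout

/-! ### Passage to homology -/

/-- A splitting of the sequence `a ⟶ x ⊞ y ⟶ b` of a commutative square. -/
noncomputable def splittingOfBiprod {C : Type*} [Category C] [Preadditive C]
    [HasBinaryBiproducts C] {a x y b : C} (i : a ⟶ x) (f : a ⟶ y) (g : x ⟶ b) (j : y ⟶ b)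
    (w : biprod.lift i (-f) ≫ biprod.desc g j = 0) {r : x ⟶ a} {r' : b ⟶ y} {s : b ⟶ x}
    (hr : i ≫ r = 𝟙 a) (hr' : j ≫ r' = 𝟙 y) (hf : r ≫ f = g ≫ r') (hs : j ≫ s = 0)
    (hx : r ≫ i + g ≫ s = 𝟙 x) (hb : r' ≫ j + s ≫ g = 𝟙 b) :
    (ShortComplex.mk (biprod.lift i (-f)) (biprod.desc g j) w).Splitting where
  r := biprod.desc r 0
  s := biprod.lift s r'
  f_r := by simp [hr]
  s_g := by rw [biprod.lift_desc, add_comm, hb]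
  id := by
    apply biprod.hom_ext' <;> apply biprod.hom_ext
    · simp [hx]
    · simp [hf]
    · simp [hs]
    · simp [hr']

section Homology

variable {ℓ : ℕ}

/-- The map of complexes given by linear maps commuting with the differentials. -/
noncomputable def complexHom (φ : ∀ k, (G.Gen k ℓ →₀ R) →ₗ[R] (H.Gen k ℓ →₀ R))
    (hφ : ∀ k, φ k ∘ₗ boundary R G k ℓ = boundary R H k ℓ ∘ₗ φ (k + 1)) :
    magnitudeComplex.{u, v} R G ℓ ⟶ magnitudeComplex R H ℓ where
  f k := ModuleCat.ofHom (φ k)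
  comm' := by
    rintro _ k rfl
    change ModuleCat.ofHom (φ (k + 1)) ≫ (magnitudeComplex R H ℓ).d (k + 1) k =
      (magnitudeComplex R G ℓ).d (k + 1) k ≫ ModuleCat.ofHom (φ k)
    rw [magnitudeComplex_d, magnitudeComplex_d]
    exact (congrArg ModuleCat.ofHom (hφ k)).symm

/-- Linear maps raising the degree by one, as a family indexed by pairs of degrees. -/
noncomputable def homotopyHom (D : ∀ k, (G.Gen k ℓ →₀ R) →ₗ[R] (H.Gen (k + 1) ℓ →₀ R))
    (m n : ℕ) : (magnitudeComplex.{u, v} R G ℓ).X m ⟶ (magnitudeComplex R H ℓ).X n :=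
  if h : m + 1 = n then
    ModuleCat.ofHom (D m) ≫ eqToHom (congrArg (magnitudeComplex.{u, v} R H ℓ).X h) else 0

theorem homotopyHom_succ (D : ∀ k, (G.Gen k ℓ →₀ R) →ₗ[R] (H.Gen (k + 1) ℓ →₀ R)) (k : ℕ) :
    homotopyHom R D k (k + 1) = ModuleCat.ofHom (D k) :=
  (dif_pos rfl).trans (Category.comp_id _)

/-- A homotopy from linear maps raising the degree by one. -/
noncomputable def homotopyOfLinear {a b : magnitudeComplex.{u, v} R G ℓ ⟶ magnitudeComplex R H ℓ}
    {φ ψ : ∀ k, (G.Gen k ℓ →₀ R) →ₗ[R] (H.Gen k ℓ →₀ R)}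
    (ha : ∀ k, a.f k = ModuleCat.ofHom (φ k)) (hb : ∀ k, b.f k = ModuleCat.ofHom (ψ k))
    (D : ∀ k, (G.Gen k ℓ →₀ R) →ₗ[R] (H.Gen (k + 1) ℓ →₀ R))
    (h0 : φ 0 = ψ 0 + boundary R H 0 ℓ ∘ₗ D 0)
    (hs : ∀ k, φ (k + 1) = ψ (k + 1) +
      (boundary R H (k + 1) ℓ ∘ₗ D (k + 1) + D k ∘ₗ boundary R G k ℓ)) :
    Homotopy a b where
  hom := homotopyHom R D
  zero m n hmn := dif_neg hmn
  comm k := by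
    cases k with
    | zero =>
      rw [Homotopy.dNext_zero_chainComplex, Homotopy.prevD_chainComplex, homotopyHom_succ,
        magnitudeComplex_d, ha, hb]
      refine (congrArg ModuleCat.ofHom (h0.trans ?_) :
        _ = ModuleCat.ofHom (0 + boundary R H 0 ℓ ∘ₗ D 0 + ψ 0))
      abel
    | succ k =>
      rw [Homotopy.dNext_succ_chainComplex, Homotopy.prevD_chainComplex, homotopyHom_succ,
        homotopyHom_succ, magnitudeComplex_d, magnitudeComplex_d, ha, hb]
      refine (congrArg ModuleCat.ofHom ((hs k).trans ?_) :
        _ = ModuleCat.ofHom (D k ∘ₗ boundary R G k ℓ +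
          boundary R H (k + 1) ℓ ∘ₗ D (k + 1) + ψ (k + 1)))
      abel

end Homology

/-! ### The retractions, the section and the splitting -/

variable {A X Y P : DirGraph.{u}} {i : A ⟶ X} {f : A ⟶ Y} {g : X ⟶ P} {j : Y ⟶ P}

/-- The retraction of the magnitude chains of `X` onto those of `A`. -/
noncomputable def IsInitialEmbedding.retraction (hi : IsInitialEmbedding i) (ℓ : ℕ) :
    (magnitudeChains.{u, v} R ℓ).obj X ⟶ (magnitudeChains R ℓ).obj A :=
  complexHom R (fun k => comap R i Set.univ k ℓ)
    (fun k => comap_comp_boundary R hi.isConvexOn k ℓ)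

theorem IsInitialEmbedding.map_comp_retraction (hi : IsInitialEmbedding i) (ℓ : ℕ) :
    (magnitudeChains.{u, v} R ℓ).map i ≫ hi.retraction R ℓ = 𝟙 _ :=
  HomologicalComplex.hom_ext _ _ fun k =>
    congrArg ModuleCat.ofHom (hi.comap_comp_chainMap R k ℓ)

theorem IsMetricPushout.retraction_comp_map (h : IsMetricPushout i f g j)
    (hi : IsInitialEmbedding i) (ℓ : ℕ) :
    hi.retraction R ℓ ≫ (magnitudeChains.{u, v} R ℓ).map f =
      (magnitudeChains R ℓ).map g ≫ h.isInitialEmbedding.retraction R ℓ :=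
  HomologicalComplex.hom_ext _ _ fun k =>
    congrArg ModuleCat.ofHom (h.chainMap_comp_comap R hi k ℓ)

theorem IsMetricPushout.exists_section (h : IsMetricPushout i f g j) (hi : IsInitialEmbedding i)
    (hp : Nonempty A.V → ∃ p : X.V → A.V, IsProjection i p) (ℓ : ℕ) :
    ∃ s : (magnitudeChains.{u, v} R ℓ).obj P ⟶ (magnitudeChains R ℓ).obj X,
      (magnitudeChains R ℓ).map j ≫ s = 0 ∧
      Nonempty (Homotopy (𝟙 _) (hi.retraction R ℓ ≫ (magnitudeChains R ℓ).map i +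
        (magnitudeChains R ℓ).map g ≫ s)) ∧
      Nonempty (Homotopy (𝟙 _)
        (h.isInitialEmbedding.retraction R ℓ ≫ (magnitudeChains R ℓ).map j +
          s ≫ (magnitudeChains R ℓ).map g)) := by
  -- There is no function to an empty `A` from a nonempty `X`, so the disjoint case is treated
  -- without a projection.
  rcases isEmpty_or_nonempty A.V with hA | hA
  · refine ⟨complexHom R (fun k => comap R g (Set.range (vmap i))ᶜ k ℓ)
      (fun k => comap_comp_boundary R h.isConvexOn k ℓ), ?_, ⟨Homotopy.ofEq ?_⟩,
      ⟨Homotopy.ofEq ?_⟩⟩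
    · exact HomologicalComplex.hom_ext _ _ fun k =>
        congrArg ModuleCat.ofHom (h.comap_comp_chainMap R k ℓ)
    · exact HomologicalComplex.hom_ext _ _ fun k =>
        congrArg ModuleCat.ofHom (h.id_eq_left_of_isEmpty R k ℓ)
    · exact HomologicalComplex.hom_ext _ _ fun k =>
        congrArg ModuleCat.ofHom (h.id_eq_right_of_isEmpty R k ℓ)
  · obtain ⟨p, hp⟩ := hp hA
    obtain ⟨p', hp', hpp⟩ := h.exists_isProjection hi hp
    have : Nonempty X.V := hA.map (vmap i)
    obtain ⟨r, hr⟩ := h.exists_leftInverse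
    refine ⟨complexHom R
      (fun k => comap R g (Set.range (vmap i))ᶜ k ℓ + prismMap R i j p r k ℓ) (fun k => ?_), ?_,
      ⟨homotopyOfLinear R (fun _ => rfl) (fun _ => rfl)
        (fun k => projHomotopy R i p k ℓ) ?_ fun k => ?_⟩,
      ⟨homotopyOfLinear R (fun _ => rfl) (fun _ => rfl)
        (fun k => projHomotopy R j p' k ℓ) ?_ fun k => ?_⟩⟩
    · rw [LinearMap.add_comp, LinearMap.comp_add, comap_comp_boundary R h.isConvexOn,
        h.prismMap_comp_boundary R hr hi hp]
    · refine HomologicalComplex.hom_ext _ _ fun k => ?_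
      have : (comap R g (Set.range (vmap i))ᶜ k ℓ + prismMap R i j p r k ℓ) ∘ₗ
          chainMap R j k ℓ = 0 := by
        rw [LinearMap.add_comp, h.comap_comp_chainMap R, prismMap_comp_chainMap R, add_zero]
      exact congrArg ModuleCat.ofHom this
    · have := boundary_comp_projHomotopy_zero R hp ℓ
      rw [h.projEnd_eq_left R hr hi hp] at this
      exact this
    · have := boundary_comp_projHomotopy_succ R hp k ℓ
      rw [h.projEnd_eq_left R hr hi hp] at this
      exact this
    · have := boundary_comp_projHomotopy_zero R hp' ℓ
      rw [h.projEnd_eq_right R hr hi hp hp' hpp] at this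
      exact this
    · have := boundary_comp_projHomotopy_succ R hp' k ℓ
      rw [h.projEnd_eq_right R hr hi hp hp' hpp] at this
      exact this

theorem nonempty_splitting_mayerVietoris (hi : IsCofibration i) (hP : IsPushout i f g j)
    (k ℓ : ℕ) : Nonempty (mayerVietoris.{u, v} R hP.toCommSq k ℓ).Splitting := by
  have h := hi.isMetricPushout hP
  have hi' := hi.isInitialEmbedding
  obtain ⟨s, hjs, ⟨HX⟩, ⟨HP⟩⟩ :=
    h.exists_section.{u, v} R hi' (fun _ => hi.exists_isProjection) ℓ
  let F := HomologicalComplex.homologyFunctor (ModuleCat.{max u v} R) (ComplexShape.down ℕ) k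
  have e1 := congrArg F.map (hi'.map_comp_retraction.{u, v} R ℓ)
  have e2 := congrArg F.map (h.isInitialEmbedding.map_comp_retraction.{u, v} R ℓ)
  have e3 := congrArg F.map (h.retraction_comp_map.{u, v} R hi' ℓ)
  have e4 := congrArg F.map hjs
  -- Only here is homology needed: the other identities already hold for chains, while these two
  -- hold up to homotopy.
  have e5 : F.map _ = F.map _ := HX.homologyMap_eq k
  have e6 : F.map _ = F.map _ := HP.homologyMap_eq k
  simp only [F.map_comp, F.map_id, F.map_zero, F.map_add] at e1 e2 e3 e4 e5 e6
  exact ⟨splittingOfBiprod (C := ModuleCat.{max u v} R) _ _ _ _ _ e1 e2 e3 e4 e5.symm e6.symm⟩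

end DirGraph

theorem mainTheorem7 (R : Type v) [CommRing R] {A X Y P : DirGraph.{u}}
    (i : A ⟶ X) (f : A ⟶ Y) (g : X ⟶ P) (j : Y ⟶ P)
    (hi : DirGraph.IsCofibration i) (hP : IsPushout i f g j) (k ℓ : ℕ) :
    (DirGraph.mayerVietoris R hP.toCommSq k ℓ).ShortExact ∧
      Nonempty (DirGraph.mayerVietoris R hP.toCommSq k ℓ).Splitting := by
  obtain ⟨s⟩ := DirGraph.nonempty_splitting_mayerVietoris R hi hP k ℓ
  exact ⟨s.shortExact, ⟨s⟩⟩
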